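/- Setting. Let $\mathscr M$ be a (Hausdorff) real analytic manifold of dimension $N$. A real analytic rigged distribution of rank $m+1$ on $\mathscr M$ is a triple $(\mathscr D,\mathscr D^I,\mathscr T)$, where $\mathscr D$ is a real analytic regular distribution of rank $m+1$, $\mathscr D^I\subset\mathscr D$ is an involutive real analytic regular sub-distribution of rank $m$, and $\mathscr T$ is a nowhere vanishing real analytic section of $\mathscr D/\mathscr D^I$. Let $V^{II}$ be the smallest family of real analytic local vector fields (defined on open subsets of $\mathscr M$) that contains all iterated Lie brackets $[Y_1,[Y_2,\dots,[Y_r,Z]\dots]]$, $r\ge 0$ (for $r=0$ this is $Z$), with $Z$ a local real analytic field in $\mathscr D^I$ and $Y_i$ local real analytic fields with $\mathscr T=Y_i \bmod \mathscr D^I$, and that is closed under sums, multiplication by real analytic functions and restriction to smaller open sets. Put $\mathscr D^{II}_x=\{X_x : X\in V^{II}\}$; $(V^{II},\mathscr D^{II})$ is the secondary distribution and $p=\max_{x\in\mathscr M}\dim\mathscr D^{II}_x$ is the secondary rank. For an open set $U$, a finite tuple $(W_i)$ of real analytic fields on $U$ is a set of generators for $(V^{II}|_U,\mathscr D^{II}|_U)$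 if for every open $O\subset U$ the fields in $V^{II}$ with domain $O$ are exactly the combinations $\sum_i f^iW_i|_O$ with real analytic $f^i:O\to\mathbb R$, and some $p$ of the $W_i$ are pointwise linearly independent on an open dense subset of $U$. Let $\mathbb T$ be a real analytic vector field on an open set $V\subset\mathscr M$ with $\mathscr T=\mathbb T\bmod\mathscr D^I$ on $V$. A $\mathbb T$-adapted set of generators on $V$ is given by integers $\nu\ge0$ and $R_0,\dots,R_\nu\ge 0$ and a set of generators $(W_{\ell(a)j})$, $0\le a\le\nu$, $0\le\ell\le a$, $1\le j\le R_a$, for $(V^{II}|_V,\mathscr D^{II}|_V)$ such that: (1) the fields $W_{0(a)j}$ span $\mathscr D^I_x$ at each $x\in V$, and $R_0+\dots+R_\nu=m$; (2) $W_{\ell(a)j}=\operatorname{ad}_{\mathbb T}^{\ell}W_{0(a)j}$, where $\operatorname{ad}_{\mathbb T}X=[\mathbb T,X]$; (3) at each point of $V$, $\operatorname{ad}_{\mathbb T}^{a+1}W_{0(a)j}$ is a linear combination of the $W_{\ell'(b)j'}$ with $b\le a$. The indices $\ell(a)j$ are ordered lexicographically as triples $(\ell,a,j)$. Let $\Phi^{\mathbb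 T}_\tau$ be the flow of $\mathbb T$ in $V$ and $\Phi^{\mathbb T}_{\tau*}$ the push-forward by it, so that $\Phi^{\mathbb T}_{\tau*}(X)|_x=d\Phi^{\mathbb T}_\tau\big(X|_{\Phi^{\mathbb T}_{-\tau}(x)}\big)$. Theorem. Let $(W_{\ell(a)j})$ be a $\mathbb T$-adapted set of generators on $V$ as above, let $U$ be a non-empty connected open set whose closure is compact and contained in $V$, and let $T>0$ and $\rho\in(0,1)$. Then there is $\varepsilon_o\in(0,T)$ such that for every $\omega\in(0,\varepsilon_o)$ there are real numbers $\tau_{\ell(a)j}\in[\rho\omega,\omega]$, one for each index $\ell(a)j$, with the following properties: (1) if $\ell(a)j<\tilde\ell(\tilde a)\tilde\jmath$ in the lexicographic order, then $\tau_{\ell(a)j}>\tau_{\tilde\ell(\tilde a)\tilde\jmath}$; (2) $\Phi^{\mathbb T}_{-\tau_{\ell(a)j}}$ is defined at every point of $U$ for each index, and the surrogate fields $\mathbb W_{\ell(a)j}=\Phi^{\mathbb T}_{\tau_{\ell(a)j}*}(W_{0(a)j})$ are a set of generators for $(V^{II}|_U,\mathscr D^{II}|_U)$. -/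

import Mathlib

open Set
open scoped Manifold ContDiff

noncomputable section

namespace Rigged

section

variable {N : ℕ} {M : Type*} [TopologicalSpace M] [ChartedSpace (EuclideanSpace ℝ (Fin N)) M]
  [IsManifold (𝓡 N) ω M]

variable (N M) in
/-- Vector fields on the `N`-dimensional manifold `M`, as (not necessarily continuous) sections of
the tangent bundle.  A local vector field with open domain `O` is represented by such a section,
whose values outside `O` are never used. -/
abbrev VField : Type _ := (x : M) → TangentSpace (𝓡 N) x

/-- The local vector field `X` is real analytic on the set `O`. -/
def AnalyticVF (O : Set M) (X : VField N M) : Prop :=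
  ContMDiffOn (𝓡 N) (𝓡 N).tangent ω (fun x => (⟨x, X x⟩ : TangentBundle (𝓡 N) M)) O

/-- The real function `f` is real analytic on the set `O`. -/
def AnalyticFun (O : Set M) (f : M → ℝ) : Prop :=
  ContMDiffOn (𝓡 N) 𝓘(ℝ, ℝ) ω f O

variable (N M) in
/-- A family of subspaces of the tangent spaces. -/
abbrev Distribution : Type _ := (x : M) → Submodule ℝ (TangentSpace (𝓡 N) x)

/-- A real analytic regular distribution of rank `p`: locally the span of `p` real analytic
pointwise linearly independent vector fields. -/
def IsRegularDistribution (D : Distribution N M) (p : ℕ) : Prop :=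
  ∀ x₀ : M, ∃ O : Set M, IsOpen O ∧ x₀ ∈ O ∧ ∃ X : Fin p → VField N M,
    (∀ i, AnalyticVF O (X i)) ∧
    ∀ x ∈ O, LinearIndependent ℝ (fun i => X i x) ∧
      D x = Submodule.span ℝ (range fun i => X i x)

/-- The distribution `D` is involutive: the Lie bracket of two local real analytic vector fields
with values in `D` has values in `D`. -/
def IsInvolutive (D : Distribution N M) : Prop :=
  ∀ (O : Set M) (X Y : VField N M), IsOpen O → AnalyticVF O X → AnalyticVF O Y →
    (∀ x ∈ O, X x ∈ D x) → (∀ x ∈ O, Y x ∈ D x) →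
    ∀ x ∈ O, VectorField.mlieBracket (𝓡 N) X Y x ∈ D x

variable (N M) in
/-- A real analytic rigged distribution `(𝒟, 𝒟ᴵ, 𝒯)` of rank `m + 1` on `M`.  The quotient
`𝒟ₓ / 𝒟ᴵₓ` is regarded as a subspace of `TₓM / 𝒟ᴵₓ`. -/
structure RiggedDistribution (m : ℕ) where
  /-- the distribution `𝒟` -/
  D : Distribution N M
  /-- the sub-distribution `𝒟ᴵ` -/
  DI : Distribution N M
  /-- the section `𝒯` of `𝒟 / 𝒟ᴵ` -/
  sec : (x : M) → TangentSpace (𝓡 N) x ⧸ DI x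
  regular_D : IsRegularDistribution D (m + 1)
  regular_DI : IsRegularDistribution DI m
  DI_le : ∀ x, DI x ≤ D x
  involutive_DI : IsInvolutive DI
  sec_mem : ∀ x, sec x ∈ (D x).map (DI x).mkQ
  sec_ne_zero : ∀ x, sec x ≠ 0
  sec_analytic : ∀ x₀ : M, ∃ O : Set M, IsOpen O ∧ x₀ ∈ O ∧ ∃ X : VField N M,
    AnalyticVF O X ∧ ∀ x ∈ O, (DI x).mkQ (X x) = sec x

variable {m : ℕ} (𝓓 : RiggedDistribution N M m)

/-- `Y` is a real analytic vector field on the open set `O` with `𝒯 = Y mod 𝒟ᴵ` on `O`. -/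
def Represents (O : Set M) (Y : VField N M) : Prop :=
  AnalyticVF O Y ∧ ∀ x ∈ O, (𝓓.DI x).mkQ (Y x) = 𝓓.sec x

/-- `VII 𝓓 O X` says that the local vector field `X` with open domain `O` belongs to `Vᴵᴵ`, the
smallest family of local real analytic vector fields which contains all iterated brackets
`[Y₁, [Y₂, …, [Y_r, Z]…]]`, `r ≥ 0` (for `r = 0` this is `Z`), where `Z` is a local real analytic
vector field in `𝒟ᴵ` and `𝒯 = Yᵢ mod 𝒟ᴵ`, and which is closed under sums, multiplication by real
analytic functions and restriction to smaller open sets. -/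
inductive VII : Set M → VField N M → Prop
  | bracket (O : Set M) (hO : IsOpen O) (Z : VField N M) (hZ : AnalyticVF O Z)
      (hZI : ∀ x ∈ O, Z x ∈ 𝓓.DI x) (Ys : List (VField N M))
      (hYs : ∀ Y ∈ Ys, Represents 𝓓 O Y) :
      VII O (Ys.foldr (fun Y X => VectorField.mlieBracket (𝓡 N) Y X) Z)
  | add (O : Set M) (X Y : VField N M) (hX : VII O X) (hY : VII O Y) :
      VII O (fun x => X x + Y x)
  | smul (O : Set M) (f : M → ℝ) (X : VField N M) (hf : AnalyticFun (N := N) O f)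
      (hX : VII O X) : VII O (fun x => f x • X x)
  | restrict (O O' : Set M) (X X' : VField N M) (hX : VII O X) (hO' : IsOpen O') (hsub : O' ⊆ O)
      (heq : ∀ x ∈ O', X' x = X x) : VII O' X'

theorem VII.isOpen {O : Set M} {X : VField N M} (h : VII 𝓓 O X) : IsOpen O := by
  induction h with
  | bracket O hO => exact hO
  | add O X Y _ _ ihX _ => exact ihX
  | smul O f X _ _ ih => exact ih
  | restrict O O' X X' _ hO' => exact hO'

/-- The subspace `𝒟ᴵᴵₓ = {Xₓ : X ∈ Vᴵᴵ}` of `TₓM`. -/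
def DII (x : M) : Submodule ℝ (TangentSpace (𝓡 N) x) where
  carrier := {v | ∃ (O : Set M) (X : VField N M), x ∈ O ∧ VII 𝓓 O X ∧ X x = v}
  add_mem' := by
    rintro _ _ ⟨O, X, hx, hX, rfl⟩ ⟨O', X', hx', hX', rfl⟩
    have ho := hX.isOpen.inter hX'.isOpen
    exact ⟨O ∩ O', fun y => X y + X' y, ⟨hx, hx'⟩,
      .add _ _ _ (.restrict _ _ _ _ hX ho inter_subset_left fun _ _ => rfl)
        (.restrict _ _ _ _ hX' ho inter_subset_right fun _ _ => rfl), rfl⟩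
  zero_mem' := by
    obtain ⟨O, hO, hx, Y, hY, -⟩ := 𝓓.sec_analytic x
    obtain ⟨O', hO', hx', F, hF, -⟩ := 𝓓.regular_D x
    have h0 : VII 𝓓 O' (fun y => (0 : ℝ) • F 0 y) := by
      refine .restrict O' O' (([] : List (VField N M)).foldr
        (fun Y X => VectorField.mlieBracket (𝓡 N) Y X) (fun y => 0)) _
        (.bracket O' hO' _ ?_ (fun y _ => Submodule.zero_mem _) [] (by simp)) hO' le_rfl
        (fun y _ => by simp)
      exact (Bundle.contMDiff_zeroSection (IB := 𝓡 N) (F := EuclideanSpace ℝ (Fin N)) ℝ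
        (TangentSpace (𝓡 N) : M → Type)).contMDiffOn
    exact ⟨O', _, hx', h0, by simp⟩
  smul_mem' := by
    rintro c _ ⟨O, X, hx, hX, rfl⟩
    exact ⟨O, fun y => c • X y, hx, .smul O (fun _ => c) X contMDiffOn_const hX, rfl⟩

/-- The secondary rank: the maximal dimension of the spaces `𝒟ᴵᴵₓ`. -/
def secondaryRank : ℕ := ⨆ x : M, Module.finrank ℝ (DII 𝓓 x)

/-- `(W i)` is a (finite) set of generators for `(Vᴵᴵ|_U, 𝒟ᴵᴵ|_U)`: the `W i` are real analytic
on `U`, the local vector fields in `Vᴵᴵ` with domain in `U` are exactly the linear combinations of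
the `W i` with real analytic coefficients, and, if `p` is the secondary rank, then `p` of the `W i`
are pointwise linearly independent on an open dense subset of `U`. -/
def IsGenerators {ι : Type} [Fintype ι] (U : Set M) (W : ι → VField N M) : Prop :=
  (∀ i, AnalyticVF U (W i)) ∧
  (∀ O : Set M, IsOpen O → O ⊆ U → ∀ Y : VField N M,
    VII 𝓓 O Y ↔ ∃ f : ι → M → ℝ, (∀ i, AnalyticFun (N := N) O (f i)) ∧
      ∀ x ∈ O, Y x = ∑ i, f i x • W i x) ∧
  ∃ s : Finset ι, s.card = secondaryRank 𝓓 ∧ ∃ G : Set M, IsOpen G ∧ G ⊆ U ∧ U ⊆ closure G ∧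
    ∀ x ∈ G, LinearIndependent ℝ (fun i : s => W i x)

/-- The indices `ℓ(a)j` with `0 ≤ a ≤ ν`, `0 ≤ ℓ ≤ a` and `j` in a set of `R a` elements. -/
abbrev Index (ν : ℕ) (R : Fin (ν + 1) → ℕ) : Type :=
  (a : Fin (ν + 1)) × Fin ((a : ℕ) + 1) × Fin (R a)

namespace Index

variable {ν : ℕ} {R : Fin (ν + 1) → ℕ}

/-- the entry `a` of `ℓ(a)j` -/
def a (A : Index ν R) : Fin (ν + 1) := A.1

/-- the entry `ℓ` of `ℓ(a)j` -/
def ell (A : Index ν R) : ℕ := A.2.1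

/-- the entry `j` of `ℓ(a)j` -/
def j (A : Index ν R) : Fin (R A.a) := A.2.2

/-- The lexicographic order of the triples `(ℓ, a, j)`. -/
def LexLT (A B : Index ν R) : Prop :=
  A.ell < B.ell ∨ (A.ell = B.ell ∧ (A.a < B.a ∨ (A.a = B.a ∧ (A.j : ℕ) < (B.j : ℕ))))

end Index

/-- The `k`-fold iterated bracket `[𝕋, [𝕋, …, [𝕋, X]…]]`. -/
def adIter (𝕋 : VField N M) (k : ℕ) (X : VField N M) : VField N M :=
  (fun Z => VectorField.mlieBracket (𝓡 N) 𝕋 Z)^[k] X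

/-- The array `W_{ℓ(a)j} = ad_𝕋^ℓ W_{0(a)j}` built on its first row `W₀ a j = W_{0(a)j}`. -/
def array {ν : ℕ} {R : Fin (ν + 1) → ℕ} (𝕋 : VField N M)
    (W₀ : (a : Fin (ν + 1)) → Fin (R a) → VField N M) (A : Index ν R) : VField N M :=
  adIter 𝕋 A.ell (W₀ A.a A.j)

/-- The array `W_{ℓ(a)j} = ad_𝕋^ℓ W_{0(a)j}` is a `𝕋`-adapted set of generators for
`(Vᴵᴵ|_V, 𝒟ᴵᴵ|_V)`. -/
structure IsAdapted (V : Set M) (𝕋 : VField N M) {ν : ℕ} {R : Fin (ν + 1) → ℕ}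
    (W₀ : (a : Fin (ν + 1)) → Fin (R a) → VField N M) : Prop where
  generators : IsGenerators 𝓓 V (array 𝕋 W₀)
  span_first_row : ∀ x ∈ V,
    𝓓.DI x = Submodule.span ℝ (range fun i : (a : Fin (ν + 1)) × Fin (R a) => W₀ i.1 i.2 x)
  card_first_row : ∑ a, R a = m
  last_bracket : ∀ (a : Fin (ν + 1)) (j : Fin (R a)), ∀ x ∈ V,
    adIter 𝕋 ((a : ℕ) + 1) (W₀ a j) x ∈
      Submodule.span ℝ {v | ∃ B : Index ν R, B.a ≤ a ∧ v = array 𝕋 W₀ B x}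

/-- `y = Φ^𝕋_t(x)`: the integral curve of `𝕋`, as a vector field on `V`, which starts from `x`
is defined up to time `t` (of any sign) and is then at `y`. -/
def FlowsTo (V : Set M) (𝕋 : VField N M) (t : ℝ) (x y : M) : Prop :=
  ∃ γ : ℝ → M, IsMIntegralCurveOn γ 𝕋 (uIcc 0 t) ∧ (∀ s ∈ uIcc 0 t, γ s ∈ V) ∧
    γ 0 = x ∧ γ t = y

open scoped Classical in
/-- The flow `Φ^𝕋_t` of the vector field `𝕋` on `V` (with a junk value at the points where it is
not defined). -/
def flow (V : Set M) (𝕋 : VField N M) (t : ℝ) (x : M) : M :=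
  if h : ∃ y, FlowsTo V 𝕋 t x y then h.choose else x

/-- The push-forward `Φ^𝕋_{t*}(X)`, whose value at `x` is the image of `X` at `p = Φ^𝕋_{-t}(x)`
under the differential of `Φ^𝕋_t` at `p`. -/
def pushforward (V : Set M) (𝕋 : VField N M) (t : ℝ) (X : VField N M) : VField N M :=
  fun x => mfderiv (𝓡 N) (𝓡 N) (flow V 𝕋 t) (flow V 𝕋 (-t) x) (X (flow V 𝕋 (-t) x))

end

end Rigged

end

/-! Write `W_A` for the adapted generators. On `V` one has `[𝕋, W_A] = ∑ C_AB W_B` with analytic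
`C`: inside a column `(a)j` the bracket only shifts `ℓ` to `ℓ + 1`, and the bracket of the last
entry is a field of `Vᴵᴵ`, hence an analytic combination of the generators (`exists_bracketCoeff`).
Let `e` be the fundamental solution of `e' = C e`, `e(0) = 1`, along the integral curve from `x`.
Uniqueness for the variational equation gives `Φ_{t*}(W_A)|_x = ∑ e_AB(-t) W_B|_x` (`transport_eq`,
`exists_local_transports`). So the surrogate fields arise from the `W_B` by the analytic matrix `S`
whose row `A = ℓ(a)j` is row `0(a)j` of `e` at time `-τ_A`.

An invertible analytic matrix carries generators to generators (`IsGenerators.of_matrix`), so it is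
enough that `det S ≠ 0` on `U`. Fix numbers `s_A ∈ [ρ, 1]`, strictly decreasing in the lexicographic
order, and put `τ_A = ω s_A`. By the shift rule the successive derivatives of row `0(a)j` of `e` are
the rows `1(a)j, …, a(a)j`, which at time `0` are rows of the identity. Taylor's formula then
describes row `A` of `S` up to `O(ω^(a+1))`. After multiplying row `ℓ(a)j` by `ω^(-a)` and column
`k(b)i` by `ω^(b-k)`, the matrix is within `O(ω)` of a block diagonal one, whose blocks are
Vandermonde matrices with the distinct nodes `-s_{ℓ(a)j}` and columns divided by `k!`
(`det_limitMatrix_ne_zero`). The threshold for `ω` is locally uniform in `x`, and compactness of the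
closure of `U` makes it uniform.

The analytic dependence of the flow and of `e` on the point comes from the analytic inverse function
theorem on a Banach space of paths (`exists_analytic_flow`). Uniqueness of solutions makes the local
constructions agree in different charts. -/

noncomputable section

namespace Rigged

open Filter Topology

/-! ### Superposition operators on spaces of continuous functions -/

section AnalyticFlow

variable {F : Type*} [NormedAddCommGroup F] [NormedSpace ℝ F]
variable {K : Type*} [TopologicalSpace K] [CompactSpace K]

/-- A continuous multilinear map acts pointwise on continuous functions. -/
def pointwiseMultilinear {n : ℕ} (p : ContinuousMultilinearMap ℝ (fun _ : Fin n => F) F) :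
    ContinuousMultilinearMap ℝ (fun _ : Fin n => C(K, F)) C(K, F) :=
  MultilinearMap.mkContinuous
    { toFun := fun η => ⟨fun s => p fun i => η i s,
        p.cont.comp (continuous_pi fun i => (η i).continuous)⟩
      map_update_add' := by
        intro _ η i x y
        ext s
        have h : ∀ z : C(K, F), (fun j => (Function.update η i z) j s) =
            Function.update (fun j => η j s) i (z s) := by
          intro z
          ext j
          rcases eq_or_ne j i with rfl | h <;> simp [*]
        simp [h]
      map_update_smul' := by
        intro _ η i c x
        ext s
        have h : ∀ z : C(K, F), (fun j => (Function.update η i z) j s) =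
            Function.update (fun j => η j s) i (z s) := by
          intro z
          ext j
          rcases eq_or_ne j i with rfl | h <;> simp [*]
        simp [h] }
    ‖p‖ (fun η => by
      refine (ContinuousMap.norm_le _ (by positivity)).2 fun s => ?_
      refine (p.le_opNorm _).trans ?_
      gcongr with i
      exact (η i).norm_coe_le_norm s)

theorem norm_pointwiseMultilinear_le {n : ℕ}
    (p : ContinuousMultilinearMap ℝ (fun _ : Fin n => F) F) :
    ‖pointwiseMultilinear (K := K) p‖ ≤ ‖p‖ :=
  MultilinearMap.mkContinuous_norm_le _ (norm_nonneg _) _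

/-- The superposition operator `γ ↦ f ∘ γ` on continuous functions is analytic near the constant
function `x₀` when `f` is analytic at `x₀`. -/
theorem exists_analyticAt_superposition [CompleteSpace F] {f : F → F} {x₀ : F}
    (hf : AnalyticAt ℝ f x₀) :
    ∃ S : C(K, F) → C(K, F), AnalyticAt ℝ S (ContinuousMap.const K x₀) ∧
      ∀ᶠ γ in 𝓝 (ContinuousMap.const K x₀), ∀ s, S γ s = f (γ s) := by
  obtain ⟨p, r, hp⟩ := hf
  let P : FormalMultilinearSeries ℝ C(K, F) C(K, F) := fun n => pointwiseMultilinear (p n)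
  -- Acting pointwise does not increase norms, so the series on functions converges at least where
  -- the series of `f` does.
  have hrad : p.radius ≤ P.radius :=
    FormalMultilinearSeries.radius_le_of_le fun n => norm_pointwiseMultilinear_le (p n)
  have hpos : 0 < P.radius := (hp.r_pos.trans_le hp.r_le).trans_le hrad
  refine ⟨fun γ => P.sum (γ - ContinuousMap.const K x₀), ?_, ?_⟩
  · have h := (P.hasFPowerSeriesOnBall hpos).comp_sub (ContinuousMap.const K x₀)
    rw [zero_add] at h
    exact h.analyticAt
  · filter_upwards [Metric.eball_mem_nhds (ContinuousMap.const K x₀) hp.r_pos] with γ hγ s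
    set y : C(K, F) := γ - ContinuousMap.const K x₀
    have hy : y ∈ Metric.eball (0 : C(K, F)) r := by
      rw [Metric.mem_eball, edist_eq_enorm_sub] at hγ
      rw [Metric.mem_eball, edist_eq_enorm_sub, sub_zero]
      exact hγ
    have hy' : y ∈ Metric.eball (0 : C(K, F)) P.radius :=
      Metric.eball_subset_eball (hp.r_le.trans hrad) hy
    -- Evaluation at `s` is continuous and linear, so it turns the series on functions into the
    -- series of `f` at the point `y s`.
    have h1 := (ContinuousMap.evalCLM ℝ s).hasSum (P.hasSum hy')
    have hys : y s ∈ Metric.eball (0 : F) r := by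
      rw [Metric.mem_eball, edist_eq_enorm_sub, sub_zero] at hy ⊢
      refine lt_of_le_of_lt ?_ hy
      rw [enorm_le_iff_norm_le]
      exact y.norm_coe_le_norm s
    have h2 := hp.hasSum hys
    have h3 := h1.unique h2
    have h4 : x₀ + y s = γ s := by simp [y]
    rw [h4] at h3
    exact h3

end AnalyticFlow

/-! ### Analytic local flows from the inverse function theorem on path space -/

section AnalyticFlow

variable {F : Type*} [NormedAddCommGroup F] [NormedSpace ℝ F]

/-- The interval `[-1, 1]`, the parameter space of the rescaled integral curves. -/
abbrev TimeInterval : Type := Icc (-1 : ℝ) 1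

/-- The projection of the real line to `[-1, 1]`. -/
def toTimeInterval (s : ℝ) : TimeInterval := projIcc (-1) 1 (by norm_num) s

theorem continuous_toTimeInterval : Continuous toTimeInterval :=
  continuous_projIcc (h := by norm_num)

theorem coe_toTimeInterval {s : ℝ} (hs : s ∈ Icc (-1 : ℝ) 1) : (toTimeInterval s : ℝ) = s := by
  rw [toTimeInterval, projIcc_of_mem _ hs]

/-- The primitive which vanishes at `0`, as an operator on continuous paths. -/
def primitiveCLM : C(TimeInterval, F) →L[ℝ] C(TimeInterval, F) :=
  LinearMap.mkContinuous
    { toFun := fun η => ⟨fun s => ∫ r in (0 : ℝ)..s, η (toTimeInterval r), by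
        have h : Continuous fun r => η (toTimeInterval r) :=
          η.continuous.comp continuous_toTimeInterval
        exact (intervalIntegral.continuous_primitive
          (fun a b => h.intervalIntegrable a b) 0).comp continuous_subtype_val⟩
      map_add' := fun η θ => by
        ext s
        exact intervalIntegral.integral_add
          ((η.continuous.comp continuous_toTimeInterval).intervalIntegrable _ _)
          ((θ.continuous.comp continuous_toTimeInterval).intervalIntegrable _ _)
      map_smul' := fun c η => by
        ext s
        exact intervalIntegral.integral_smul c _ }
    1 (fun η => by
      refine (ContinuousMap.norm_le _ (by positivity)).2 fun s => ?_
      refine (intervalIntegral.norm_integral_le_of_norm_le_const (C := ‖η‖)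
        fun r _ => η.norm_coe_le_norm _).trans ?_
      have h : |(s : ℝ) - 0| ≤ 1 := by rw [sub_zero]; exact abs_le.2 s.2
      rw [one_mul]
      exact mul_le_of_le_one_right (norm_nonneg _) h)

theorem primitiveCLM_apply (η : C(TimeInterval, F)) (s : TimeInterval) :
    primitiveCLM η s = ∫ r in (0 : ℝ)..s, η (toTimeInterval r) := rfl

/-- The path `s ↦ γ (σ s)`. -/
def rescale (γ : C(TimeInterval, F)) (σ : TimeInterval) : C(TimeInterval, F) :=
  ⟨fun s => γ (toTimeInterval (σ * s)), γ.continuous.comp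
    (continuous_toTimeInterval.comp (continuous_const.mul continuous_subtype_val))⟩

theorem mul_mem_timeInterval {σ s : ℝ} (hσ : σ ∈ Icc (-1 : ℝ) 1) (hs : s ∈ Icc (-1 : ℝ) 1) :
    σ * s ∈ Icc (-1 : ℝ) 1 := by
  rw [mem_Icc, ← abs_le] at *
  rw [abs_mul]
  exact mul_le_one₀ hσ (abs_nonneg _) hs

omit [NormedSpace ℝ F] in
theorem dist_rescale_le (γ : C(TimeInterval, F)) (σ : TimeInterval) (x₀ : F) :
    dist (rescale γ σ) (ContinuousMap.const _ x₀) ≤ dist γ (ContinuousMap.const _ x₀) :=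
  (ContinuousMap.dist_le dist_nonneg).2 fun s =>
    ContinuousMap.dist_apply_le_dist (f := γ) (g := ContinuousMap.const _ x₀)
      (toTimeInterval (σ * s))

theorem primitiveCLM_rescale (η : C(TimeInterval, F)) (σ : TimeInterval) (s : TimeInterval) :
    (σ : ℝ) • primitiveCLM (rescale η σ) s = primitiveCLM η (toTimeInterval (σ * s)) := by
  rw [primitiveCLM_apply, primitiveCLM_apply, coe_toTimeInterval (mul_mem_timeInterval σ.2 s.2)]
  have h := intervalIntegral.smul_integral_comp_mul_left (a := 0) (b := (s : ℝ))
    (fun r => η (toTimeInterval r)) (σ : ℝ)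
  rw [mul_zero] at h
  rw [← h]
  congr 1
  refine intervalIntegral.integral_congr fun r hr => ?_
  have hr' : r ∈ Icc (-1 : ℝ) 1 := by
    rw [mem_Icc, ← abs_le]
    have h1 := abs_sub_left_of_mem_uIcc hr
    rw [sub_zero, sub_zero] at h1
    exact h1.trans (abs_le.2 s.2)
  simp only [rescale, ContinuousMap.coe_mk, coe_toTimeInterval hr']

/-- The map whose zeros in the last component are the rescaled integral curves of `f`, where `S`
is the superposition operator of `f`. -/
def curveEquation (S : C(TimeInterval, F) → C(TimeInterval, F))
    (q : (F × ℝ) × C(TimeInterval, F)) : (F × ℝ) × C(TimeInterval, F) :=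
  (q.1, q.2 - (ContinuousLinearMap.const ℝ TimeInterval q.1.1 + q.1.2 • primitiveCLM (S q.2)))

/-- Slowing down a solution with parameter `t` by the factor `σ` gives a solution with parameter `t
* σ`. Together with local uniqueness this identifies the endpoints for varying `t` with the points
of a single curve. -/
theorem curveEquation_rescale {S : C(TimeInterval, F) → C(TimeInterval, F)} {x : F} {t : ℝ}
    {γ : C(TimeInterval, F)} {σ : TimeInterval} (h : (curveEquation S ((x, t), γ)).2 = 0)
    (hS : S (rescale γ σ) = rescale (S γ) σ) :
    curveEquation S ((x, t * σ), rescale γ σ) = ((x, t * σ), 0) := by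
  refine Prod.ext rfl (ContinuousMap.ext fun s => ?_)
  have h1 := congrArg (fun g : C(TimeInterval, F) => g (toTimeInterval (σ * s))) h
  simp only [curveEquation, ContinuousMap.sub_apply, ContinuousMap.add_apply,
    ContinuousMap.smul_apply, ContinuousMap.zero_apply] at h1 ⊢
  rw [hS, mul_smul, primitiveCLM_rescale]
  exact h1

/-- A vector field which is analytic at `x₀` has a local flow which is analytic at `(x₀, 0)`. -/
theorem exists_analytic_flow [CompleteSpace F] {f : F → F} {x₀ : F} (hf : AnalyticAt ℝ f x₀) :
    ∃ φ : F × ℝ → F, AnalyticAt ℝ φ (x₀, 0) ∧ (∀ᶠ x in 𝓝 x₀, φ (x, 0) = x) ∧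
      ∀ᶠ q in 𝓝 (x₀, (0 : ℝ)), HasDerivAt (fun t => φ (q.1, t)) (f (φ q)) q.2 := by
  obtain ⟨S, hSa, hS⟩ := exists_analyticAt_superposition (K := TimeInterval) hf
  set γ₀ : C(TimeInterval, F) := ContinuousMap.const _ x₀ with hγ₀
  set a₀ : F × ℝ := (x₀, 0) with ha₀
  have hGa : AnalyticAt ℝ (curveEquation S) (a₀, γ₀) := by
    have h1 : AnalyticAt ℝ (fun q : (F × ℝ) × C(TimeInterval, F) => S q.2) (a₀, γ₀) :=
      hSa.comp_of_eq analyticAt_snd rfl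
    have h2 : AnalyticAt ℝ (fun q : (F × ℝ) × C(TimeInterval, F) => primitiveCLM (S q.2))
        (a₀, γ₀) := 
      AnalyticAt.comp (g := fun y => primitiveCLM (F := F) y)
        ((primitiveCLM (F := F)).analyticAt _) h1
    have h3 : AnalyticAt ℝ (fun q : (F × ℝ) × C(TimeInterval, F) => q.1.1) (a₀, γ₀) :=
      analyticAt_fst.comp_of_eq analyticAt_fst rfl
    have h4 : AnalyticAt ℝ (fun q : (F × ℝ) × C(TimeInterval, F) => q.1.2) (a₀, γ₀) :=
      analyticAt_snd.comp_of_eq analyticAt_fst rfl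
    have h5 : AnalyticAt ℝ (fun q : (F × ℝ) × C(TimeInterval, F) =>
        ContinuousLinearMap.const ℝ TimeInterval q.1.1) (a₀, γ₀) :=
      AnalyticAt.comp (g := fun y => ContinuousLinearMap.const ℝ TimeInterval (M := F) y)
        (ContinuousLinearMap.analyticAt _ _) h3
    exact analyticAt_fst.prod (analyticAt_snd.sub (h5.add (h4.smul h2)))
  have hGc : ContDiffAt ℝ ω (curveEquation S) (a₀, γ₀) := hGa.contDiffAt
  -- The integral term carries the factor `t`, which vanishes at the base point. So the partial
  -- derivative in the path is the identity, and the full derivative is triangular, hence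
  -- invertible.
  let Λ : (F × ℝ) →L[ℝ] C(TimeInterval, F) :=
    -((ContinuousLinearMap.const ℝ TimeInterval).comp (ContinuousLinearMap.fst ℝ F ℝ) +
      (ContinuousLinearMap.snd ℝ F ℝ).smulRight (primitiveCLM (S γ₀)))
  let e : ((F × ℝ) × C(TimeInterval, F)) ≃L[ℝ] ((F × ℝ) × C(TimeInterval, F)) :=
    (ContinuousLinearEquiv.refl ℝ (F × ℝ)).skewProd
      (ContinuousLinearEquiv.refl ℝ C(TimeInterval, F)) Λ
  have hGd : HasFDerivAt (curveEquation S)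
      (e : ((F × ℝ) × C(TimeInterval, F)) →L[ℝ] ((F × ℝ) × C(TimeInterval, F))) (a₀, γ₀) := by
    have h1 := (primitiveCLM.hasFDerivAt (x := S γ₀)).comp (a₀, γ₀)
      (hSa.differentiableAt.hasFDerivAt.comp (a₀, γ₀)
        (hasFDerivAt_snd (𝕜 := ℝ) (p := (a₀, γ₀))))
    have h2 := (hasFDerivAt_fst (𝕜 := ℝ) (p := (a₀, γ₀))).fst
    have h3 := (hasFDerivAt_fst (𝕜 := ℝ) (p := (a₀, γ₀))).snd
    have h4 := (hasFDerivAt_fst (𝕜 := ℝ) (p := (a₀, γ₀))).prodMk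
      ((hasFDerivAt_snd (𝕜 := ℝ) (p := (a₀, γ₀))).sub
        ((((ContinuousLinearMap.const ℝ TimeInterval).hasFDerivAt (x := x₀)).comp (a₀, γ₀) h2).add
          (h3.smul h1)))
    refine h4.congr_fderiv ?_
    ext q
    all_goals simp [e, Λ, ha₀]
  have hG0 : curveEquation S (a₀, γ₀) = (a₀, 0) := by
    refine Prod.ext rfl (ContinuousMap.ext fun s => ?_)
    simp [curveEquation, ha₀, hγ₀]
  have hstrict := hGc.hasStrictFDerivAt' hGd (by simp)
  set H := hGc.localInverse hGd (by simp) with hH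
  have hHa : ContDiffAt ℝ ω H (a₀, 0) := by
    rw [← hG0]; exact hGc.to_localInverse hGd (by simp)
  have hH0 : H (a₀, 0) = (a₀, γ₀) := by
    rw [← hG0]; exact hGc.localInverse_apply_image hGd (by simp)
  have hleft : ∀ᶠ q in 𝓝 (a₀, γ₀), H (curveEquation S q) = q :=
    hstrict.eventually_left_inverse
  have hright : ∀ᶠ q in 𝓝 (a₀, (0 : C(TimeInterval, F))), curveEquation S (H q) = q := by
    rw [← hG0]; exact hstrict.eventually_right_inverse
  -- The implicit function: `Γ (x, t)` is the path which solves `γ = x + t ∫ f ∘ γ`.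
  let Γ : F × ℝ → C(TimeInterval, F) := fun a => (H (a, 0)).2
  have hΓa : ContDiffAt ℝ ω Γ a₀ :=
    
    (ContDiffAt.comp (g := H) (f := fun a : F × ℝ => (a, (0 : C(TimeInterval, F)))) a₀ hHa
      (contDiffAt_id.prodMk contDiffAt_const)).snd
  have hΓ0 : Γ a₀ = γ₀ := by simp only [Γ, hH0]
  have hΓeq : ∀ᶠ a in 𝓝 a₀, curveEquation S (a, Γ a) = (a, 0) := by
    have hc : ContinuousAt (fun a : F × ℝ => (a, (0 : C(TimeInterval, F)))) a₀ := by fun_prop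
    filter_upwards [hc.eventually hright] with a ha
    have h1 : (H (a, 0)).1 = a := congrArg Prod.fst ha
    have h2 : H (a, 0) = (a, Γ a) := Prod.ext h1 rfl
    rw [← h2, ha]
  obtain ⟨ε, hε, hεH⟩ : ∃ ε > 0, ∀ a γ, dist a a₀ < ε → dist γ γ₀ < ε →
      H (curveEquation S (a, γ)) = (a, γ) ∧ ∀ s, S γ s = f (γ s) := by
    obtain ⟨ε, hε, h⟩ := Metric.eventually_nhds_iff.1 hleft
    obtain ⟨ε', hε', h'⟩ := Metric.eventually_nhds_iff.1 hS
    refine ⟨min ε ε', lt_min hε hε', fun a γ h1 h2 => ⟨h ?_, h' (h2.trans_le (min_le_right _ _))⟩⟩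
    rw [Prod.dist_eq]
    exact max_lt (h1.trans_le (min_le_left _ _)) (h2.trans_le (min_le_left _ _))
  obtain ⟨δ, hδ, hδΓ⟩ : ∃ δ > 0, ∀ a, dist a a₀ < δ →
      dist a a₀ < ε ∧ dist (Γ a) γ₀ < ε ∧ curveEquation S (a, Γ a) = (a, 0) := by
    have h1 : ∀ᶠ a in 𝓝 a₀, dist (Γ a) γ₀ < ε := by
      have := hΓa.continuousAt.eventually (Metric.ball_mem_nhds _ hε)
      rwa [hΓ0] at this
    exact Metric.eventually_nhds_iff.1
      (Filter.Eventually.and (Metric.ball_mem_nhds a₀ hε) (h1.and hΓeq))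
  have hdist : ∀ (x : F) (t : ℝ), dist x x₀ < δ → |t| < δ → dist (x, t) a₀ < δ := by
    intro x t hx ht
    rw [Prod.dist_eq]
    exact max_lt hx (by simpa [ha₀] using ht)
  -- The rescaled path is as close to `γ₀` as the original one and solves the equation with `t * σ`;
  -- the left inverse property makes such a solution unique.
  have hscale : ∀ (x : F) (t : ℝ), dist x x₀ < δ → |t| < δ → ∀ σ : TimeInterval,
      Γ (x, t * σ) = rescale (Γ (x, t)) σ := by
    intro x t hx ht σ
    obtain ⟨-, h2, h3⟩ := hδΓ _ (hdist x t hx ht)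
    have hσ : |t * σ| < δ := by
      rw [abs_mul]
      exact (mul_le_of_le_one_right (abs_nonneg _) (abs_le.2 σ.2)).trans_lt ht
    obtain ⟨h1', -, -⟩ := hδΓ _ (hdist x (t * σ) hx hσ)
    have hr : dist (rescale (Γ (x, t)) σ) γ₀ < ε := (dist_rescale_le _ _ _).trans_lt h2
    obtain ⟨h4, h5⟩ := hεH _ _ h1' hr
    have h6 : S (rescale (Γ (x, t)) σ) = rescale (S (Γ (x, t))) σ := by
      ext s
      rw [h5]
      exact ((hεH _ _ h1' h2).2 _).symm
    rw [curveEquation_rescale (congrArg Prod.snd h3) h6] at h4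
    exact congrArg Prod.snd h4
  have hint : ∀ (x : F) (t : ℝ), dist x x₀ < δ → |t| < δ → ∀ s : TimeInterval,
      Γ (x, t) s = x + t • ∫ r in (0 : ℝ)..s, f (Γ (x, t) (toTimeInterval r)) := by
    intro x t hx ht s
    obtain ⟨h1, h2, h3⟩ := hδΓ _ (hdist x t hx ht)
    have h4 := congrArg (fun q => q.2 s) h3
    have h5 : ∀ s, S (Γ (x, t)) s = f (Γ (x, t) s) := (hεH _ _ h1 h2).2
    simp only [curveEquation, ContinuousMap.sub_apply, ContinuousMap.add_apply,
      ContinuousMap.smul_apply, ContinuousMap.zero_apply, primitiveCLM_apply, h5, sub_eq_zero] at h4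
    exact h4
  let one : TimeInterval := ⟨1, by norm_num, le_rfl⟩
  refine ⟨fun a => Γ a one, ?_, ?_, ?_⟩
  · have h1 : ContDiffAt ℝ ω (fun a => ContinuousMap.evalCLM ℝ one (Γ a)) a₀ :=
      ContDiffAt.comp (g := fun y => ContinuousMap.evalCLM ℝ (M := F) one y) a₀
        (ContinuousLinearMap.contDiff _).contDiffAt hΓa
    exact h1.analyticAt
  · filter_upwards [Metric.ball_mem_nhds x₀ hδ] with x hx
    rw [hint x 0 hx (by simpa using hδ), zero_smul, add_zero]
  · filter_upwards [Metric.ball_mem_nhds a₀ hδ] with q hq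
    obtain ⟨x, t⟩ := q
    rw [Metric.mem_ball, Prod.dist_eq, max_lt_iff] at hq
    have hx : dist x x₀ < δ := hq.1
    have ht : |t| < δ := by simpa [ha₀] using hq.2
    -- With `t₁` slightly larger than `|t|`, the values at all times near `t` are read off the one
    -- path `Γ (x, t₁)`, to which the fundamental theorem of calculus applies.
    obtain ⟨t₁, ht₁, ht₁δ⟩ := exists_between ht
    have ht₁0 : 0 < t₁ := (abs_nonneg t).trans_lt ht₁
    have ht₁' : |t₁| < δ := by rwa [abs_of_pos ht₁0]
    set γ := Γ (x, t₁) with hγ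
    have hφ : ∀ u : ℝ, |u| < t₁ → Γ (x, u) one = γ (toTimeInterval (u / t₁)) := by
      intro u hu
      have hmem : u / t₁ ∈ Icc (-1 : ℝ) 1 := by
        rw [mem_Icc, ← abs_le, abs_div, abs_of_pos ht₁0]
        exact (div_le_one ht₁0).2 hu.le
      have h := hscale x t₁ hx ht₁' ⟨u / t₁, hmem⟩
      have h' : t₁ * (u / t₁) = u := by field_simp
      rw [h'] at h
      rw [h]
      simp [rescale, one, hγ]
    obtain ⟨h1, h2, -⟩ := hδΓ _ (hdist x t₁ hx ht₁')
    have h5 : ∀ s, S γ s = f (γ s) := (hεH _ _ h1 h2).2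
    have hcont : Continuous fun r => f (γ (toTimeInterval r)) := by
      simp only [← h5]
      exact (S γ).continuous.comp continuous_toTimeInterval
    have hmain : HasDerivAt
        (fun u => x + t₁ • ∫ r in (0 : ℝ)..(u / t₁), f (γ (toTimeInterval r)))
        (t₁ • (t₁⁻¹ • f (γ (toTimeInterval (t / t₁))))) t := by
      have h6 := (hcont.integral_hasStrictDerivAt 0 (t / t₁)).hasDerivAt
      have h7 : HasDerivAt (fun u : ℝ => u / t₁) t₁⁻¹ t := by
        simpa using (hasDerivAt_id t).div_const t₁
      exact ((h6.scomp t h7).const_smul t₁).const_add x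
    rw [smul_smul, mul_inv_cancel₀ ht₁0.ne', one_smul] at hmain
    change HasDerivAt (fun u => Γ (x, u) one) (f (Γ (x, t) one)) t
    rw [hφ t ht₁]
    refine hmain.congr_of_eventuallyEq ?_
    have hev : ∀ᶠ u in 𝓝 t, |u| < t₁ := continuous_abs.continuousAt.eventually_lt_const ht₁
    filter_upwards [hev] with u hu
    have hmem : u / t₁ ∈ Icc (-1 : ℝ) 1 := by
      rw [mem_Icc, ← abs_le, abs_div, abs_of_pos ht₁0]
      exact (div_le_one ht₁0).2 hu.le
    rw [hφ u hu, hint x t₁ hx ht₁', coe_toTimeInterval hmem]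

end AnalyticFlow

/-! ### Transport of vector fields by a flow in a normed space -/

section ChartLevel

variable {G : Type*} [NormedAddCommGroup G] [NormedSpace ℝ G]

/-- Grönwall's inequality, applied to `r` for positive times and to its reflection for negative
ones. -/
theorem eq_zero_of_norm_deriv_le {r r' : ℝ → G} {K δ : ℝ}
    (hr : ∀ t, |t| < δ → HasDerivAt r (r' t) t) (hK : ∀ t, |t| < δ → ‖r' t‖ ≤ K * ‖r t‖)
    (h0 : r 0 = 0) {t : ℝ} (ht : |t| < δ) : r t = 0 := by
  have key : ∀ (ρ ρ' : ℝ → G), (∀ t, |t| < δ → HasDerivAt ρ (ρ' t) t) →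
      (∀ t, |t| < δ → ‖ρ' t‖ ≤ K * ‖ρ t‖) → ρ 0 = 0 → ρ |t| = 0 := by
    intro ρ ρ' h1 h2 h3
    have hlt : ∀ s ∈ Icc 0 |t|, |s| < δ := fun s hs => by
      rw [abs_of_nonneg hs.1]; exact hs.2.trans_lt ht
    exact eq_zero_of_abs_deriv_le_mul_abs_self_of_eq_zero_right (f := ρ) (f' := ρ') (K := K)
      (a := 0) (b := |t|) (fun s hs => (h1 s (hlt s hs)).continuousAt.continuousWithinAt)
      (fun s hs => (h1 s (hlt s (Ico_subset_Icc_self hs))).hasDerivWithinAt) h3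
      (fun s hs => h2 s (hlt s (Ico_subset_Icc_self hs))) |t| ⟨abs_nonneg t, le_rfl⟩
  rcases le_total 0 t with h | h
  · have := key r r' hr hK h0
    rwa [abs_of_nonneg h] at this
  · have := key (fun s => r (-s)) (fun s => -r' (-s))
      (fun s hs => by
        have h1 := (hr (-s) (by rwa [abs_neg])).scomp s (hasDerivAt_neg s)
        simpa [Function.comp_def] using h1)
      (fun s hs => by rw [norm_neg]; exact hK (-s) (by rwa [abs_neg])) (by simpa using h0)
    simpa [abs_of_nonpos h] using this

variable {E : Type*} [NormedAddCommGroup E] [NormedSpace ℝ E]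

/-- The variational equation for an analytic flow. -/
theorem hasDerivAt_fderiv_flow {T : E → E} {ψ : E × ℝ → E} {q : E × ℝ}
    (hψ : ContDiffAt ℝ ω ψ q) (hT : DifferentiableAt ℝ T (ψ q))
    (hd : ∀ᶠ z in 𝓝 q, HasDerivAt (fun t => ψ (z.1, t)) (T (ψ z)) z.2) (v : E) :
    HasDerivAt (fun t => fderiv ℝ ψ (q.1, t) (v, 0)) (fderiv ℝ T (ψ q) (fderiv ℝ ψ q (v, 0)))
      q.2 := by
  have hdiff : DifferentiableAt ℝ (fderiv ℝ ψ) q :=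
    (hψ.fderiv_right (m := 1) (by simp)).differentiableAt (by simp)
  have hψd : DifferentiableAt ℝ ψ q := hψ.differentiableAt (by simp)
  have hpath : HasDerivAt (fun t : ℝ => (q.1, t)) ((0 : E), (1 : ℝ)) q.2 :=
    (hasDerivAt_const _ _).prodMk (hasDerivAt_id _)
  have h1 : HasDerivAt (fun t => fderiv ℝ ψ (q.1, t)) (fderiv ℝ (fderiv ℝ ψ) q (0, 1)) q.2 :=
    HasFDerivAt.comp_hasDerivAt (f := fun t : ℝ => (q.1, t)) q.2 hdiff.hasFDerivAt hpath
  have h2 := h1.clm_apply (hasDerivAt_const q.2 ((v, 0) : E × ℝ))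
  -- The mixed second derivatives commute, so the time derivative of the spatial differential is the
  -- spatial differential of `∂ₜψ = T ∘ ψ`.
  have hsymm := (hψ.isSymmSndFDerivAt (by simp)) (0, 1) (v, 0)
  have hev : (fun z => fderiv ℝ ψ z (0, 1)) =ᶠ[𝓝 q] fun z => T (ψ z) := by
    filter_upwards [hd, (hψ.eventually (by simp))] with z hz hz'
    have hp : HasDerivAt (fun t : ℝ => (z.1, t)) ((0 : E), (1 : ℝ)) z.2 :=
      (hasDerivAt_const _ _).prodMk (hasDerivAt_id _)
    exact (HasFDerivAt.comp_hasDerivAt (f := fun t : ℝ => (z.1, t)) z.2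
      (hz'.differentiableAt (by simp)).hasFDerivAt hp).unique hz
  have h3 : HasFDerivAt (fun z => fderiv ℝ ψ z (0, 1)) ((fderiv ℝ T (ψ q)).comp (fderiv ℝ ψ q)) q :=
    (hT.hasFDerivAt.comp q hψd.hasFDerivAt).congr_of_eventuallyEq hev
  have h4 := hdiff.hasFDerivAt.clm_apply (hasFDerivAt_const ((0, 1) : E × ℝ) q)
  have h5 := congrArg (fun l => l (v, 0)) (h4.unique h3)
  simp at h5
  simp only [map_zero, add_zero] at h2
  rw [hsymm, h5] at h2
  exact h2

variable {ι : Type} [Fintype ι] [DecidableEq ι]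

/-- The flow `ψ` of `T` together with the fundamental solution `e` of `e' = C e` along it, and the
way in which they move a family of vector fields with `[T, W_A] = ∑ C_AB W_B`. -/
structure IsLocalTransport (T : E → E) (C : ι → ι → E → ℝ) (W : ι → E → E) (ψ : E × ℝ → E)
    (e : E × ℝ → ι → ι → ℝ) (y₀ : E) (δ : ℝ) : Prop where
  pos : 0 < δ
  analytic_flow : ∀ y ∈ Metric.ball y₀ δ, ∀ t, |t| < δ → ContDiffAt ℝ ω ψ (y, t)
  analytic_coeff : ∀ y ∈ Metric.ball y₀ δ, ∀ t, |t| < δ → ContDiffAt ℝ ω e (y, t)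
  flow_zero : ∀ y ∈ Metric.ball y₀ δ, ψ (y, 0) = y
  coeff_zero : ∀ y ∈ Metric.ball y₀ δ, ∀ A B, e (y, 0) A B = if A = B then 1 else 0
  deriv_flow : ∀ y ∈ Metric.ball y₀ δ, ∀ t, |t| < δ →
    HasDerivAt (fun s => ψ (y, s)) (T (ψ (y, t))) t
  deriv_coeff : ∀ y ∈ Metric.ball y₀ δ, ∀ t, |t| < δ → ∀ A B,
    HasDerivAt (fun s => e (y, s) A B) (∑ D, C A D (ψ (y, t)) * e (y, t) D B) t
  transport : ∀ y ∈ Metric.ball y₀ δ, ∀ t, |t| < δ → ∀ A,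
    W A (ψ (y, t)) = fderiv ℝ (fun z => ψ (z, t)) y (∑ B, e (y, t) A B • W B y)
  inverse : ∀ y ∈ Metric.ball y₀ δ, ∀ t, |t| < δ → ψ (ψ (y, -t), t) = y

omit [DecidableEq ι] in
/-- The solutions of the variational equation which describe the transported fields agree. -/
theorem transport_eq {T : E → E} {C : ι → ι → E → ℝ} {W : ι → E → E} {ψ : E × ℝ → E}
    {e : E × ℝ → ι → ι → ℝ} {y : E} {δ K : ℝ}
    (hψ : ∀ t, |t| < δ → ContDiffAt ℝ ω ψ (y, t))
    (hT : ∀ t, |t| < δ → DifferentiableAt ℝ T (ψ (y, t)))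
    (hW : ∀ t, |t| < δ → ∀ A, DifferentiableAt ℝ (W A) (ψ (y, t)))
    (hC : ∀ t, |t| < δ → ∀ A, fderiv ℝ (W A) (ψ (y, t)) (T (ψ (y, t))) =
      fderiv ℝ T (ψ (y, t)) (W A (ψ (y, t))) + ∑ B, C A B (ψ (y, t)) • W B (ψ (y, t)))
    (hKT : ∀ t, |t| < δ → ‖fderiv ℝ T (ψ (y, t))‖ ≤ K)
    (hKC : ∀ t, |t| < δ → ∀ A B, |C A B (ψ (y, t))| ≤ K)
    (hd : ∀ t, |t| < δ → ∀ᶠ z in 𝓝 (y, t), HasDerivAt (fun s => ψ (z.1, s)) (T (ψ z)) z.2)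
    (he : ∀ t, |t| < δ → ∀ A B,
      HasDerivAt (fun s => e (y, s) A B) (∑ D, C A D (ψ (y, t)) * e (y, t) D B) t)
    (h0 : ∀ A, W A (ψ (y, 0)) = fderiv ℝ ψ (y, 0) (∑ B, e (y, 0) A B • W B y, 0))
    {t : ℝ} (ht : |t| < δ) (A : ι) :
    W A (ψ (y, t)) = fderiv ℝ ψ (y, t) (∑ B, e (y, t) A B • W B y, 0) := by
  -- The defect `r` solves the homogeneous linear equation `r_A' = dT(r_A) + ∑ C_AB r_B`: the
  -- bracket relation gives it for the first term, the variational equation and `e' = C e` for the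
  -- second. It vanishes at time `0`, hence always.
  let r : ℝ → ι → E := fun t A => W A (ψ (y, t)) - ∑ B, e (y, t) A B • fderiv ℝ ψ (y, t) (W B y, 0)
  let r' : ℝ → ι → E := fun t A =>
    fderiv ℝ T (ψ (y, t)) (r t A) + ∑ B, C A B (ψ (y, t)) • r t B
  have hlin : ∀ t A, fderiv ℝ ψ (y, t) (∑ B, e (y, t) A B • W B y, 0) =
      ∑ B, e (y, t) A B • fderiv ℝ ψ (y, t) (W B y, 0) := by
    intro t A
    have : ((∑ B, e (y, t) A B • W B y, 0) : E × ℝ) = ∑ B, e (y, t) A B • ((W B y, 0) : E × ℝ) := by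
      ext <;> simp [Prod.fst_sum, Prod.snd_sum]
    rw [this, map_sum]
    simp only [map_smul]
  have hr : ∀ t, |t| < δ → HasDerivAt r (r' t) t := by
    intro t ht
    rw [hasDerivAt_pi]
    intro A
    have h1 : HasDerivAt (fun s => W A (ψ (y, s))) (fderiv ℝ (W A) (ψ (y, t)) (T (ψ (y, t)))) t :=
      HasFDerivAt.comp_hasDerivAt (f := fun s => ψ (y, s)) t (hW t ht A).hasFDerivAt
        (hd t ht).self_of_nhds
    have h2 : HasDerivAt (fun s => ∑ B, e (y, s) A B • fderiv ℝ ψ (y, s) (W B y, 0))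
        (∑ B, (e (y, t) A B • fderiv ℝ T (ψ (y, t)) (fderiv ℝ ψ (y, t) (W B y, 0)) +
          (∑ D, C A D (ψ (y, t)) * e (y, t) D B) • fderiv ℝ ψ (y, t) (W B y, 0))) t := by
      refine HasDerivAt.fun_sum fun B _ => ?_
      exact (he t ht A B).smul (hasDerivAt_fderiv_flow (q := (y, t)) (hψ t ht) (hT t ht) (hd t ht) _)
    refine (h1.sub h2).congr_deriv ?_
    simp only [r', r, hC t ht A, map_sub, map_sum, map_smul, Finset.sum_add_distrib, smul_sub,
      Finset.sum_sub_distrib, Finset.smul_sum, Finset.sum_smul, smul_smul]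
    rw [Finset.sum_comm (f := fun B D => (C A D (ψ (y, t)) * e (y, t) D B) •
      fderiv ℝ ψ (y, t) (W B y, 0))]
    abel
  have hK : ∀ t, |t| < δ → ‖r' t‖ ≤ (K + Fintype.card ι * K) * ‖r t‖ := by
    intro t ht
    have hK0 : 0 ≤ K := (norm_nonneg _).trans (hKT t ht)
    rw [pi_norm_le_iff_of_nonneg (by positivity)]
    intro A
    refine (norm_add_le _ _).trans ?_
    rw [add_mul]
    refine add_le_add ?_ ?_
    · refine ((fderiv ℝ T (ψ (y, t))).le_opNorm _).trans ?_
      exact mul_le_mul (hKT t ht) (norm_le_pi_norm _ _) (norm_nonneg _) hK0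
    · refine (norm_sum_le _ _).trans ?_
      have : ∀ B ∈ Finset.univ, ‖C A B (ψ (y, t)) • r t B‖ ≤ K * ‖r t‖ := by
        intro B _
        rw [norm_smul]
        exact mul_le_mul (hKC t ht A B) (norm_le_pi_norm _ _) (norm_nonneg _) hK0
      refine (Finset.sum_le_sum this).trans ?_
      rw [Finset.sum_const, Finset.card_univ, nsmul_eq_mul, mul_assoc]
  have hz := eq_zero_of_norm_deriv_le hr hK (by
    ext A
    simp only [r, Pi.zero_apply]
    rw [h0, hlin, sub_self]) ht
  have := congrFun hz A
  rw [hlin]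
  exact sub_eq_zero.1 this

/-- The flow and the fundamental solution are the two components of one flow, that of the field `(T,
C e)` on `E × (ι → ι → ℝ)` started at the identity matrix, so both are analytic jointly in point and
time. -/
theorem exists_isLocalTransport [CompleteSpace E] {T : E → E} {C : ι → ι → E → ℝ} {W : ι → E → E}
    {y₀ : E} (hT : ContDiffAt ℝ ω T y₀) (hC : ∀ A B, ContDiffAt ℝ ω (C A B) y₀)
    (hW : ∀ A, ContDiffAt ℝ ω (W A) y₀)
    (hbr : ∀ᶠ y in 𝓝 y₀, ∀ A,
      fderiv ℝ (W A) y (T y) = fderiv ℝ T y (W A y) + ∑ B, C A B y • W B y) :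
    ∃ (ψ : E × ℝ → E) (e : E × ℝ → ι → ι → ℝ) (δ : ℝ), IsLocalTransport T C W ψ e y₀ δ := by
  let I : ι → ι → ℝ := fun A B => if A = B then 1 else 0
  let f : E × (ι → ι → ℝ) → E × (ι → ι → ℝ) :=
    fun p => (T p.1, fun A B => ∑ D, C A D p.1 * p.2 D B)
  have hf : ContDiffAt ℝ ω f (y₀, I) := by
    refine (ContDiffAt.comp (g := T) (y₀, I) hT contDiffAt_fst).prodMk ?_
    refine contDiffAt_pi.2 fun A => contDiffAt_pi.2 fun B => ContDiffAt.sum fun D _ => ?_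
    refine (ContDiffAt.comp (g := C A D) (y₀, I) (hC A D) contDiffAt_fst).mul ?_
    exact contDiffAt_pi.1 (contDiffAt_pi.1 contDiffAt_snd D) B
  obtain ⟨φ, hφa, hφ0, hφd⟩ := exists_analytic_flow hf.analyticAt
  let i : E × ℝ → (E × (ι → ι → ℝ)) × ℝ := fun q => ((q.1, I), q.2)
  have hi : ContDiff ℝ ω i := (contDiff_fst.prodMk contDiff_const).prodMk contDiff_snd
  have hφi : ContDiffAt ℝ ω (fun q => φ (i q)) (y₀, 0) :=
    ContDiffAt.comp (g := φ) (y₀, (0 : ℝ)) hφa.contDiffAt hi.contDiffAt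
  let ψ : E × ℝ → E := fun q => (φ (i q)).1
  let e : E × ℝ → ι → ι → ℝ := fun q => (φ (i q)).2
  have hψa : ContDiffAt ℝ ω ψ (y₀, 0) := hφi.fst
  have hea : ContDiffAt ℝ ω e (y₀, 0) := hφi.snd
  have hzero : ∀ᶠ y in 𝓝 y₀, ψ (y, 0) = y ∧ e (y, 0) = I := by
    have hc : ContinuousAt (fun y : E => (y, I)) y₀ := by fun_prop
    filter_upwards [hc.eventually hφ0] with y hy
    exact ⟨congrArg Prod.fst hy, congrArg Prod.snd hy⟩
  have hψ0 : ψ (y₀, 0) = y₀ := hzero.self_of_nhds.1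
  have hderiv : ∀ᶠ q in 𝓝 (y₀, (0 : ℝ)), HasDerivAt (fun s => ψ (q.1, s)) (T (ψ q)) q.2 ∧
      ∀ A B, HasDerivAt (fun s => e (q.1, s) A B) (∑ D, C A D (ψ q) * e q D B) q.2 := by
    filter_upwards [hi.continuous.continuousAt.eventually hφd] with q hq
    exact ⟨hq.fst, fun A B => hasDerivAt_pi.1 (hasDerivAt_pi.1 hq.snd A) B⟩
  obtain ⟨k, s, hs, hlip⟩ := (hT.of_le (m := 1) (by simp)).exists_lipschitzOnWith
  -- One bound for `dT` and all the coefficients; the summands `1` leave room for it to persist near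
  -- `y₀`.
  set K : ℝ := (‖fderiv ℝ T y₀‖ + 1) + ∑ A, ∑ B, (|C A B y₀| + 1) with hKdef
  have hKle : ∀ A B, |C A B y₀| + 1 ≤ K := by
    intro A B
    have h1 : |C A B y₀| + 1 ≤ ∑ B, (|C A B y₀| + 1) :=
      Finset.single_le_sum (f := fun B => |C A B y₀| + 1) (fun _ _ => by positivity)
        (Finset.mem_univ B)
    have h2 : ∑ B, (|C A B y₀| + 1) ≤ ∑ A, ∑ B, (|C A B y₀| + 1) :=
      Finset.single_le_sum (f := fun A => ∑ B, (|C A B y₀| + 1)) (fun _ _ => by positivity)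
        (Finset.mem_univ A)
    have h3 : 0 ≤ ‖fderiv ℝ T y₀‖ + 1 := by positivity
    linarith
  have hT1 : ‖fderiv ℝ T y₀‖ + 1 ≤ K := by
    have : 0 ≤ ∑ A, ∑ B, (|C A B y₀| + 1) := by positivity
    linarith
  have hgood : ∀ᶠ y in 𝓝 y₀, DifferentiableAt ℝ T y ∧ (∀ A, DifferentiableAt ℝ (W A) y) ∧
      (∀ A, fderiv ℝ (W A) y (T y) = fderiv ℝ T y (W A y) + ∑ B, C A B y • W B y) ∧
      ‖fderiv ℝ T y‖ ≤ K ∧ (∀ A B, |C A B y| ≤ K) ∧ y ∈ s := by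
    have h1 : ∀ᶠ y in 𝓝 y₀, ‖fderiv ℝ T y‖ < ‖fderiv ℝ T y₀‖ + 1 :=
      (hT.fderiv_right (m := 0) (by simp)).continuousAt.norm.eventually_lt_const (by simp)
    have h2 : ∀ᶠ y in 𝓝 y₀, ∀ A B, |C A B y| < |C A B y₀| + 1 := by
      refine eventually_all.2 fun A => eventually_all.2 fun B => ?_
      exact (hC A B).continuousAt.abs.eventually_lt_const (by simp)
    have h3 : ∀ᶠ y in 𝓝 y₀, ∀ A, ContDiffAt ℝ ω (W A) y :=
      eventually_all.2 fun A => (hW A).eventually (by simp)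
    filter_upwards [hT.eventually (by simp), h3, hbr, h1, h2, hs] with y a1 a2 a3 a4 a5 a6
    exact ⟨a1.differentiableAt (by simp), fun A => (a2 A).differentiableAt (by simp), a3,
      a4.le.trans hT1, fun A B => (a5 A B).le.trans (hKle A B), a6⟩
  have hψc : Tendsto ψ (𝓝 (y₀, 0)) (𝓝 y₀) := by
    have := hψa.continuousAt
    rwa [ContinuousAt, hψ0] at this
  have hall := (hψa.eventually (by simp)).and ((hea.eventually (by simp)).and
    (hderiv.and (hψc.eventually hgood)))
  obtain ⟨δ₁, hδ₁, h₁⟩ := Metric.eventually_nhds_iff.1 hall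
  obtain ⟨δ₂, hδ₂, h₂⟩ := Metric.eventually_nhds_iff.1 hzero
  have hδ₃ : 0 < min δ₁ δ₂ := lt_min hδ₁ hδ₂
  obtain ⟨δ₄, hδ₄, h₄⟩ := Metric.eventually_nhds_iff.1
    (hψc.eventually (Metric.ball_mem_nhds y₀ hδ₃))
  have hmem : ∀ {δ : ℝ} {y : E} {t : ℝ}, dist y y₀ < δ → |t| < δ → dist (y, t) (y₀, 0) < δ := by
    intro δ y t hy ht
    rw [Prod.dist_eq]
    exact max_lt hy (by simpa using ht)
  have hδ5 : min (min δ₁ δ₂ / 2) δ₄ ≤ min δ₁ δ₂ / 2 := min_le_left _ _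
  have hδ6 : min δ₁ δ₂ ≤ δ₁ := min_le_left _ _
  have hδ7 : min δ₁ δ₂ ≤ δ₂ := min_le_right _ _
  have hδ8 : min (min δ₁ δ₂ / 2) δ₄ ≤ δ₄ := min_le_right _ _
  -- The half makes differences `u - t` of two admissible times admissible, and `δ₄` keeps the
  -- points `ψ (y, -t)` in the domain where the flow is controlled.
  set δ := min (min δ₁ δ₂ / 2) δ₄ with hδ
  have hδpos : 0 < δ := lt_min (half_pos hδ₃) hδ₄
  have hle₁ : δ ≤ δ₁ := by linarith
  have hle₂ : δ ≤ δ₂ := by linarith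
  have Q : ∀ y ∈ Metric.ball y₀ δ, ∀ t, |t| < δ → _ := fun y hy t ht =>
    h₁ (hmem (hy.trans_le hle₁) (ht.trans_le hle₁))
  refine ⟨ψ, e, δ, hδpos, fun y hy t ht => (Q y hy t ht).1, fun y hy t ht => (Q y hy t ht).2.1,
    fun y hy => (h₂ (hy.trans_le hle₂)).1, fun y hy A B => ?_,
    fun y hy t ht => (Q y hy t ht).2.2.1.1, fun y hy t ht A B => (Q y hy t ht).2.2.1.2 A B, ?_, ?_⟩
  · rw [(h₂ (hy.trans_le hle₂)).2]
  · intro y hy t ht A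
    have hfd : ∀ t, |t| < δ → ∀ v, fderiv ℝ ψ (y, t) (v, 0) = fderiv ℝ (fun z => ψ (z, t)) y v := by
      intro t ht v
      have h1 := ((Q y hy t ht).1.differentiableAt (by simp)).hasFDerivAt.comp y
        ((hasFDerivAt_id (𝕜 := ℝ) y).prodMk (hasFDerivAt_const t y))
      have h2 : fderiv ℝ (fun z => ψ (z, t)) y = _ := h1.fderiv
      rw [h2]
      simp
    have h0 : |(0 : ℝ)| < δ := by simpa using hδpos
    rw [← hfd t ht]
    refine transport_eq (δ := δ) (K := K) (T := T) (C := C) (fun t ht => (Q y hy t ht).1)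
      (fun t ht => (Q y hy t ht).2.2.2.1) (fun t ht => (Q y hy t ht).2.2.2.2.1)
      (fun t ht => (Q y hy t ht).2.2.2.2.2.1) (fun t ht => (Q y hy t ht).2.2.2.2.2.2.1)
      (fun t ht => (Q y hy t ht).2.2.2.2.2.2.2.1) (fun t ht => ?_)
      (fun t ht => (Q y hy t ht).2.2.1.2) (fun A => ?_) ht A
    · have h3 : ∀ᶠ z in 𝓝 (y, t), dist z (y₀, 0) < δ₁ :=
        Metric.isOpen_ball.mem_nhds (hmem (hy.trans_le hle₁) (ht.trans_le hle₁))
      filter_upwards [h3] with z hz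
      exact (h₁ hz).2.2.1.1
    · rw [hfd 0 h0, (h₂ (hy.trans_le hle₂)).1, (h₂ (hy.trans_le hle₂)).2]
      have h4 : (fun z => ψ (z, 0)) =ᶠ[𝓝 y] id := by
        filter_upwards [Metric.isOpen_ball.mem_nhds (hy.trans_le hle₂)] with z hz
        exact (h₂ hz).1
      rw [h4.fderiv_eq, fderiv_id]
      simp [I]
  · intro y hy t ht
    have ht' : |-t| < δ := by rwa [abs_neg]
    have hy₁ : dist (ψ (y, -t)) y₀ < min δ₁ δ₂ :=
      h₄ (hmem (hy.trans_le hδ8) (ht'.trans_le hδ8))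
    set y₁ := ψ (y, -t) with hy₁def
    -- Both terms are integral curves of `T` which pass through `y₁` at `u = 0`, so they agree; at
    -- `u = t` the second one is `ψ (y, 0) = y`.
    let r : ℝ → E := fun u => ψ (y₁, u) - ψ (y, u - t)
    have Q₁ : ∀ u, |u| < min δ₁ δ₂ / 2 → _ := fun u hu =>
      h₁ (hmem (hy₁.trans_le hδ6) (show |u| < δ₁ by linarith))
    have Q₂ : ∀ u, |u| < min δ₁ δ₂ / 2 → _ := fun u hu =>
      h₁ (hmem (hy.trans_le hle₁) (show |u - t| < δ₁ by
        have := abs_sub u t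
        linarith))
    have hz := eq_zero_of_norm_deriv_le (r := r) (r' := fun u => T (ψ (y₁, u)) - T (ψ (y, u - t)))
      (K := k) (δ := min δ₁ δ₂ / 2) (fun u hu => ?_) (fun u hu => ?_) ?_ (ht.trans_le hδ5)
    · have h5 : ψ (y₁, t) = ψ (y, t - t) := sub_eq_zero.1 hz
      rw [h5, sub_self]
      exact (h₂ (hy.trans_le hle₂)).1
    · exact (Q₁ u hu).2.2.1.1.sub ((Q₂ u hu).2.2.1.1.comp_sub_const u t)
    · exact hlip.norm_sub_le (Q₁ u hu).2.2.2.2.2.2.2.2 (Q₂ u hu).2.2.2.2.2.2.2.2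
    · have h6 : ψ (y₁, 0) = y₁ := (h₂ (hy₁.trans_le hδ7)).1
      change ψ (y₁, 0) - ψ (y, 0 - t) = 0
      rw [h6, zero_sub, sub_eq_zero]

end ChartLevel

/-! ### Taylor expansion and the Vandermonde limit -/

section Determinant

/-- The mean value inequality on the segment from `0` to `t`: one integration raises the order of
vanishing by one. The factor `1 / (n + 1)` is not needed and is dropped. -/
theorem abs_le_mul_pow_succ {g g' : ℝ → ℝ} {K δ : ℝ} {n : ℕ} (h0 : g 0 = 0)
    (hg : ∀ t, |t| < δ → HasDerivAt g (g' t) t) (hK : ∀ t, |t| < δ → |g' t| ≤ K * |t| ^ n)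
    (hK0 : 0 ≤ K) {t : ℝ} (ht : |t| < δ) : |g t| ≤ K * |t| ^ (n + 1) := by
  have hmem : ∀ s ∈ uIcc 0 t, |s| ≤ |t| := fun s hs => by
    simpa using abs_sub_left_of_mem_uIcc hs
  have := (convex_uIcc (0 : ℝ) t).norm_image_sub_le_of_norm_hasDerivWithin_le (f := g) (f' := g')
    (C := K * |t| ^ n) (x := 0) (y := t)
    (fun s hs => (hg s ((hmem s hs).trans_lt ht)).hasDerivWithinAt)
    (fun s hs => (hK s ((hmem s hs).trans_lt ht)).trans
      (mul_le_mul_of_nonneg_left (pow_le_pow_left₀ (abs_nonneg _) (hmem s hs) _) hK0))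
    left_mem_uIcc right_mem_uIcc
  rw [h0, sub_zero, sub_zero, Real.norm_eq_abs, Real.norm_eq_abs] at this
  rw [pow_succ, ← mul_assoc]
  exact this

/-- Taylor's formula by induction on the order, one integration per step. The derivatives are given
as a chain `g 0, g 1, …` because the rows of a fundamental solution provide them in this form. -/
theorem abs_sub_taylor_le {K δ : ℝ} (hK0 : 0 ≤ K) (a : ℕ) :
    ∀ (g : ℕ → ℝ → ℝ), (∀ k < a, ∀ t, |t| < δ → HasDerivAt (g k) (g (k + 1) t) t) →
      (∀ t, |t| < δ → ∃ d, |d| ≤ K ∧ HasDerivAt (g a) d t) →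
      ∀ t, |t| < δ →
        |g 0 t - ∑ k ∈ Finset.range (a + 1), g k 0 * (t ^ k / (k.factorial : ℝ))| ≤
          K * |t| ^ (a + 1) := by
  induction a with
  | zero =>
    intro g _ h t ht
    choose! d hd hd' using h
    refine abs_le_mul_pow_succ (g := fun t => g 0 t - ∑ k ∈ Finset.range (0 + 1),
      g k 0 * (t ^ k / (k.factorial : ℝ))) (g' := d) (by simp) (fun t ht => ?_)
      (fun t ht => by simpa using hd t ht) hK0 ht
    simpa using (hd' t ht).sub_const (g 0 0)
  | succ a ih =>
    intro g h1 h2 t ht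
    have h3 := ih (fun k => g (k + 1)) (fun k hk => h1 (k + 1) (by omega)) h2
    refine abs_le_mul_pow_succ (g := fun t => g 0 t - ∑ k ∈ Finset.range (a + 1 + 1),
      g k 0 * (t ^ k / (k.factorial : ℝ))) (g' := fun t => g 1 t - ∑ k ∈ Finset.range (a + 1),
      g (k + 1) 0 * (t ^ k / (k.factorial : ℝ))) ?_ (fun t ht => ?_) h3 hK0 ht
    · simp [Finset.sum_range_succ']
    · refine (h1 0 (by omega) t ht).sub ?_
      simp only [Finset.sum_range_succ' _ (a + 1), pow_zero]
      have h4 : HasDerivAt (fun t : ℝ => ∑ k ∈ Finset.range (a + 1),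
          g (k + 1) 0 * (t ^ (k + 1) / ((k + 1).factorial : ℝ)))
          (∑ k ∈ Finset.range (a + 1), g (k + 1) 0 * (t ^ k / (k.factorial : ℝ))) t := by
        refine HasDerivAt.fun_sum fun k _ => HasDerivAt.const_mul _ ?_
        refine ((hasDerivAt_pow (k + 1) t).div_const _).congr_deriv ?_
        rw [Nat.factorial_succ]
        have : (k.factorial : ℝ) ≠ 0 := by positivity
        have : ((k : ℝ) + 1) ≠ 0 := by positivity
        push_cast
        field_simp
      exact h4.add_const _

variable {ν : ℕ} {R : Fin (ν + 1) → ℕ}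

/-- The first entry `0(a)j` of the column of `ℓ(a)j`. -/
def Index.base (A : Index ν R) : Index ν R := ⟨A.1, 0, A.2.2⟩

/-- The block Vandermonde matrix which is the limit of the rescaled coefficients of the surrogate
fields. -/
def limitMatrix (s : Index ν R → ℝ) (A B : Index ν R) : ℝ :=
  ∑ k : Fin ((A.1 : ℕ) + 1), (if (⟨A.1, k, A.2.2⟩ : Index ν R) = B then (1 : ℝ) else 0) *
    ((-s A) ^ (k : ℕ) / ((k : ℕ).factorial : ℝ))

/-- A row `l(a)j` meets only the columns `k(a)j` with the same `a` and `j`, so a kernel vector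
splits into kernel vectors of the blocks. Each block is a Vandermonde matrix with columns divided by
`k!`, and its nodes `-s` are distinct. -/
theorem det_limitMatrix_ne_zero {s : Index ν R → ℝ} (hs : Function.Injective s) :
    (Matrix.of (limitMatrix s)).det ≠ 0 := by
  intro h
  obtain ⟨v, hv, hv0⟩ := Matrix.exists_mulVec_eq_zero_iff.2 h
  refine hv (funext fun A => ?_)
  obtain ⟨a, k, j⟩ := A
  have h1 : ∀ l : Fin ((a : ℕ) + 1), ∑ k : Fin ((a : ℕ) + 1),
      (-s ⟨a, l, j⟩) ^ (k : ℕ) * (v ⟨a, k, j⟩ / ((k : ℕ).factorial : ℝ)) = 0 := by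
    intro l
    have h2 := congrFun hv0 ⟨a, l, j⟩
    simp only [Matrix.mulVec, dotProduct, Matrix.of_apply, limitMatrix, Pi.zero_apply,
      Finset.sum_mul] at h2
    rw [Finset.sum_comm] at h2
    rw [← h2]
    refine Finset.sum_congr rfl fun k _ => ?_
    rw [Finset.sum_eq_single (⟨a, k, j⟩ : Index ν R)]
    · simp; ring
    · intro B _ hB
      rw [if_neg hB.symm]; simp
    · simp
  have h3 : (Matrix.vandermonde fun l : Fin ((a : ℕ) + 1) => -s ⟨a, l, j⟩).det ≠ 0 := by
    rw [Matrix.det_vandermonde_ne_zero_iff]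
    intro l l' hl
    have h4 := hs (neg_injective hl)
    simpa using h4
  have h5 := Matrix.eq_zero_of_mulVec_eq_zero h3
    (v := fun k => v ⟨a, k, j⟩ / ((k : ℕ).factorial : ℝ)) (funext fun l => by
      simpa [Matrix.mulVec, dotProduct, Matrix.vandermonde_apply] using h1 l)
  have h6 := congrFun h5 k
  have h7 : ((k : ℕ).factorial : ℝ) ≠ 0 := by positivity
  simpa [h7] using h6

/-- The coefficients of the surrogate fields are close to a block Vandermonde matrix. -/
theorem abs_scaled_sub_limitMatrix_le {s : Index ν R → ℝ} (hs : ∀ A, s A ∈ Icc (0 : ℝ) 1)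
    {K δ w : ℝ} (hK0 : 0 ≤ K) (hw : 0 < w) (hw1 : w ≤ 1) (hwδ : w < δ)
    {e : ℝ → Index ν R → Index ν R → ℝ} (h0 : ∀ A B, e 0 A B = if A = B then 1 else 0)
    (hstep : ∀ t, |t| < δ → ∀ (a : Fin (ν + 1)) (j : Fin (R a)) (k : ℕ)
      (hk : k + 1 < (a : ℕ) + 1) (B : Index ν R),
      HasDerivAt (fun u => e u ⟨a, ⟨k, Nat.lt_of_succ_lt hk⟩, j⟩ B) (e t ⟨a, ⟨k + 1, hk⟩, j⟩ B) t)
    (hlast : ∀ t, |t| < δ → ∀ (a : Fin (ν + 1)) (j : Fin (R a)) (B : Index ν R),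
      ∃ d, |d| ≤ K ∧ HasDerivAt (fun u => e u ⟨a, Fin.last a, j⟩ B) d t) (A B : Index ν R) :
    |(w ^ (A.1 : ℕ))⁻¹ * (w ^ ((B.1 : ℕ) - (B.2.1 : ℕ)) * e (-(w * s A)) A.base B)
      - limitMatrix s A B| ≤ K * w := by
  obtain ⟨a, l, j⟩ := A
  set σ := s ⟨a, l, j⟩ with hσ
  have hσ01 : σ ∈ Icc (0 : ℝ) 1 := hs _
  set t := -(w * σ) with ht
  have htabs : |t| = w * σ := by rw [ht, abs_neg, abs_of_nonneg (mul_nonneg hw.le hσ01.1)]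
  have htw : |t| ≤ w := by rw [htabs]; exact mul_le_of_le_one_right hw.le hσ01.2
  -- The chain of successive derivatives down the column `(a)j`; only the orders `k ≤ a` are used,
  -- so the default value `0` is harmless.
  let g : ℕ → ℝ → ℝ := fun k u => if hk : k < (a : ℕ) + 1 then e u ⟨a, ⟨k, hk⟩, j⟩ B else 0
  have hg := abs_sub_taylor_le (δ := δ) hK0 a g
    (fun k hk u hu => by
      have h1 : k < (a : ℕ) + 1 := by omega
      have h2 : k + 1 < (a : ℕ) + 1 := by omega
      have h3 : g k = fun u => e u ⟨a, ⟨k, h1⟩, j⟩ B := by funext u; simp only [g, dif_pos h1]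
      have h4 : g (k + 1) = fun u => e u ⟨a, ⟨k + 1, h2⟩, j⟩ B := by
        funext u; simp only [g, dif_pos h2]
      rw [h3, h4]
      exact hstep u hu a j k h2 B)
    (fun u hu => by
      obtain ⟨d, hd, hd'⟩ := hlast u hu a j B
      refine ⟨d, hd, ?_⟩
      have h1 : (a : ℕ) < (a : ℕ) + 1 := by omega
      have h3 : g a = fun u => e u ⟨a, ⟨a, h1⟩, j⟩ B := by funext u; simp only [g, dif_pos h1]
      rw [h3]
      exact hd')
    t (htw.trans_lt hwδ)
  have hpow : (w ^ (a : ℕ)) ≠ 0 := by positivity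
  -- In column `k(a)j` the scalings `w ^ (-a)` and `w ^ (a - k)` cancel the `w ^ k` of the Taylor
  -- term exactly; the Taylor polynomial vanishes in all columns outside `(a)j`.
  have hsum : (w ^ (a : ℕ))⁻¹ * (w ^ ((B.1 : ℕ) - (B.2.1 : ℕ)) *
      ∑ k ∈ Finset.range ((a : ℕ) + 1), g k 0 * (t ^ k / (k.factorial : ℝ))) =
      limitMatrix s ⟨a, l, j⟩ B := by
    rw [limitMatrix, Finset.sum_range, Finset.mul_sum, Finset.mul_sum]
    refine Finset.sum_congr rfl fun k _ => ?_
    have hgk : g k 0 = if (⟨a, k, j⟩ : Index ν R) = B then 1 else 0 := by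
      simp only [g, k.2, dif_pos, h0]
    rw [hgk]
    split_ifs with hB
    · subst hB
      simp only [one_mul, ht, ← hσ]
      have h3 : w ^ (a : ℕ) = w ^ ((a : ℕ) - (k : ℕ)) * w ^ (k : ℕ) := by
        rw [← pow_add, Nat.sub_add_cancel (by omega)]
      have h4 : w ^ ((a : ℕ) - (k : ℕ)) ≠ 0 := by positivity
      have h5 : w ^ (k : ℕ) ≠ 0 := by positivity
      have h6 : (-(w * σ)) ^ (k : ℕ) = w ^ (k : ℕ) * (-σ) ^ (k : ℕ) := by
        rw [← mul_pow]; ring_nf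
      rw [h3, h6]
      field_simp
    · simp
  have hbase : e t (Index.base ⟨a, l, j⟩) B = g 0 t := by
    simp [g, Index.base]
  rw [hbase, ← hsum, ← mul_sub, ← mul_sub, abs_mul, abs_mul, abs_inv, abs_of_pos (pow_pos hw _),
    abs_of_pos (pow_pos hw _), inv_mul_le_iff₀ (by positivity)]
  -- The column factor is at most `1`, and the remainder has one power of `w` more than the row
  -- scaling removes.
  calc w ^ ((B.1 : ℕ) - (B.2.1 : ℕ)) * |g 0 t - _|
      ≤ 1 * (K * w ^ ((a : ℕ) + 1)) := by
        refine mul_le_mul (pow_le_one₀ hw.le hw1) (hg.trans ?_) (abs_nonneg _) zero_le_one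
        gcongr
    _ = w ^ (a : ℕ) * (K * w) := by ring

/-- For small times the coefficients of the surrogate fields form an invertible matrix. -/
theorem exists_det_ne_zero {s : Index ν R → ℝ} (hs : ∀ A, s A ∈ Icc (0 : ℝ) 1)
    (hinj : Function.Injective s) {K : ℝ} (hK0 : 0 ≤ K) :
    ∃ w₀ : ℝ, 0 < w₀ ∧ ∀ (w δ : ℝ), 0 < w → w < w₀ → w < δ →
    ∀ e : ℝ → Index ν R → Index ν R → ℝ, (∀ A B, e 0 A B = if A = B then 1 else 0) →
    (∀ t, |t| < δ → ∀ (a : Fin (ν + 1)) (j : Fin (R a)) (k : ℕ)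
      (hk : k + 1 < (a : ℕ) + 1) (B : Index ν R),
      HasDerivAt (fun u => e u ⟨a, ⟨k, Nat.lt_of_succ_lt hk⟩, j⟩ B)
        (e t ⟨a, ⟨k + 1, hk⟩, j⟩ B) t) →
    (∀ t, |t| < δ → ∀ (a : Fin (ν + 1)) (j : Fin (R a)) (B : Index ν R),
      ∃ d, |d| ≤ K ∧ HasDerivAt (fun u => e u ⟨a, Fin.last a, j⟩ B) d t) →
    (Matrix.of fun A B : Index ν R => e (-(w * s A)) A.base B).det ≠ 0 := by
  have hcont : Continuous fun M : Index ν R → Index ν R → ℝ => (Matrix.of M).det :=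
    Continuous.matrix_det (continuous_id)
  obtain ⟨r, hr, hball⟩ := Metric.isOpen_iff.1 (isOpen_ne_fun hcont continuous_const)
    (limitMatrix s) (det_limitMatrix_ne_zero hinj)
  -- The threshold depends on `s` and `K` only, not on `e`, which later makes it uniform over a
  -- neighbourhood. It ensures `w ≤ 1` and `K * w < r`, with `K + 1` guarding against `K = 0`.
  refine ⟨min 1 (r / (K + 1)), by positivity, fun w δ hw hw0 hwδ e h0 hstep hlast hdet => ?_⟩
  have hw1 : w ≤ 1 := (hw0.trans_le (min_le_left _ _)).le
  have hKw : K * w < r := by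
    have h1 : w * (K + 1) < r := (lt_div_iff₀ (by positivity)).1 (hw0.trans_le (min_le_right _ _))
    nlinarith
  let M : Index ν R → Index ν R → ℝ := fun A B =>
    (w ^ (A.1 : ℕ))⁻¹ * (w ^ ((B.1 : ℕ) - (B.2.1 : ℕ)) * e (-(w * s A)) A.base B)
  have hM : M ∈ Metric.ball (limitMatrix s) r := by
    rw [Metric.mem_ball, dist_pi_lt_iff hr]
    intro A
    rw [dist_pi_lt_iff hr]
    intro B
    exact (abs_scaled_sub_limitMatrix_le hs hK0 hw hw1 hwδ h0 hstep hlast A B).trans_lt hKw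
  refine hball hM ?_
  -- Row and column scalings multiply the determinant by scalars, so if the unscaled determinant
  -- vanished, so would the scaled one.
  have h1 := Matrix.det_mul_column (fun A : Index ν R => (w ^ (A.1 : ℕ))⁻¹)
    (Matrix.of fun A B : Index ν R =>
      w ^ ((B.1 : ℕ) - (B.2.1 : ℕ)) * e (-(w * s A)) A.base B)
  have h2 := Matrix.det_mul_row (fun B : Index ν R => w ^ ((B.1 : ℕ) - (B.2.1 : ℕ)))
    (Matrix.of fun A B : Index ν R => e (-(w * s A)) A.base B)
  simp only [Matrix.of_apply] at h1 h2
  change (Matrix.of M).det = 0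
  rw [h1, h2, hdet, mul_zero, mul_zero]

end Determinant

/-! ### Vector fields in charts and generic linear independence -/

section Charts

variable {N : ℕ} {M : Type*} [TopologicalSpace M] [ChartedSpace (EuclideanSpace ℝ (Fin N)) M]

/-- The local expression of a vector field in the preferred chart at `x₀`. -/
def chartField (x₀ : M) (X : VField N M) (y : EuclideanSpace ℝ (Fin N)) :
    EuclideanSpace ℝ (Fin N) :=
  VectorField.mpullback 𝓘(ℝ, EuclideanSpace ℝ (Fin N)) (𝓡 N) (extChartAt (𝓡 N) x₀).symm X y

theorem chartField_sum {ι : Type*} [Fintype ι] (x₀ : M) (f : ι → M → ℝ) (X : ι → VField N M)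
    (y : EuclideanSpace ℝ (Fin N)) :
    chartField x₀ (fun x => ∑ i, f i x • X i x) y =
      ∑ i, f i ((extChartAt (𝓡 N) x₀).symm y) • chartField x₀ (X i) y := by
  simp only [chartField, VectorField.mpullback_apply, map_sum, map_smul]
  rfl

theorem chartField_congr {x₀ : M} {X Y : VField N M} {y : EuclideanSpace ℝ (Fin N)}
    (h : X ((extChartAt (𝓡 N) x₀).symm y) = Y ((extChartAt (𝓡 N) x₀).symm y)) :
    chartField x₀ X y = chartField x₀ Y y := by
  simp only [chartField, VectorField.mpullback_apply, h]
  rfl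

theorem extChartAt_target_mem_nhds {x₀ : M} {y : EuclideanSpace ℝ (Fin N)}
    (hy : y ∈ (extChartAt (𝓡 N) x₀).target) : (extChartAt (𝓡 N) x₀).target ∈ 𝓝 y :=
  (isOpen_extChartAt_target x₀).mem_nhds hy

theorem extChartAt_symm_preimage_mem_nhds {x₀ : M} {O : Set M} (hO : IsOpen O)
    {y : EuclideanSpace ℝ (Fin N)} (hy : y ∈ (extChartAt (𝓡 N) x₀).target)
    (hyO : (extChartAt (𝓡 N) x₀).symm y ∈ O) : (extChartAt (𝓡 N) x₀).symm ⁻¹' O ∈ 𝓝 y :=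
  (continuousAt_extChartAt_symm'' hy).preimage_mem_nhds (hO.mem_nhds hyO)

variable [IsManifold (𝓡 N) ω M]

theorem contMDiffAt_extChartAt_symm_of_mem {x₀ : M} {y : EuclideanSpace ℝ (Fin N)}
    (hy : y ∈ (extChartAt (𝓡 N) x₀).target) :
    ContMDiffAt 𝓘(ℝ, EuclideanSpace ℝ (Fin N)) (𝓡 N) ω (extChartAt (𝓡 N) x₀).symm y :=
  (contMDiffOn_extChartAt_symm x₀).contMDiffAt (extChartAt_target_mem_nhds hy)

theorem isInvertible_mfderiv_extChartAt_symm {x₀ : M} {y : EuclideanSpace ℝ (Fin N)}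
    (hy : y ∈ (extChartAt (𝓡 N) x₀).target) :
    (mfderiv 𝓘(ℝ, EuclideanSpace ℝ (Fin N)) (𝓡 N) (extChartAt (𝓡 N) x₀).symm y).IsInvertible := by
  have : IsManifold (𝓡 N) 1 M := IsManifold.of_le (n := ω) (by simp)
  have h := isInvertible_mfderivWithin_extChartAt_symm (I := 𝓡 N) hy
  rwa [ModelWithCorners.range_eq_univ, mfderivWithin_univ] at h

theorem mfderiv_extChartAt_symm_chartField {x₀ : M} (X : VField N M)
    {y : EuclideanSpace ℝ (Fin N)} (hy : y ∈ (extChartAt (𝓡 N) x₀).target) :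
    mfderiv 𝓘(ℝ, EuclideanSpace ℝ (Fin N)) (𝓡 N) (extChartAt (𝓡 N) x₀).symm y
      (chartField x₀ X y) = X ((extChartAt (𝓡 N) x₀).symm y) :=
  (isInvertible_mfderiv_extChartAt_symm hy).self_apply_inverse _

theorem mfderiv_extChartAt_eq_chartField {x₀ x : M} (X : VField N M)
    (hx : x ∈ (extChartAt (𝓡 N) x₀).source) :
    mfderiv (𝓡 N) 𝓘(ℝ, EuclideanSpace ℝ (Fin N)) (extChartAt (𝓡 N) x₀) x (X x) =
      chartField x₀ X (extChartAt (𝓡 N) x₀ x) := by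
  have : IsManifold (𝓡 N) 1 M := IsManifold.of_le (n := ω) (by simp)
  have hy := (extChartAt (𝓡 N) x₀).map_source hx
  have h1 := mfderiv_extChartAt_symm_chartField X hy
  have h2 := mfderiv_extChartAt_comp_mfderivWithin_extChartAt_symm (I := 𝓡 N) hy
  rw [ModelWithCorners.range_eq_univ, mfderivWithin_univ] at h2
  have h3 : mfderiv (𝓡 N) 𝓘(ℝ, EuclideanSpace ℝ (Fin N)) (extChartAt (𝓡 N) x₀)
      ((extChartAt (𝓡 N) x₀).symm (extChartAt (𝓡 N) x₀ x))
      (mfderiv 𝓘(ℝ, EuclideanSpace ℝ (Fin N)) (𝓡 N) (extChartAt (𝓡 N) x₀).symm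
        (extChartAt (𝓡 N) x₀ x) (chartField x₀ X (extChartAt (𝓡 N) x₀ x))) =
      chartField x₀ X (extChartAt (𝓡 N) x₀ x) := DFunLike.congr_fun h2 _
  rw [h1] at h3
  rwa [(extChartAt (𝓡 N) x₀).left_inv hx] at h3

theorem contDiffAt_chartField {x₀ : M} {O : Set M} (hO : IsOpen O) {X : VField N M}
    (hX : AnalyticVF O X) {y : EuclideanSpace ℝ (Fin N)}
    (hy : y ∈ (extChartAt (𝓡 N) x₀).target) (hyO : (extChartAt (𝓡 N) x₀).symm y ∈ O) :
    ContDiffAt ℝ ω (chartField x₀ X) y := by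
  have h1 := ContMDiffAt.mpullback_vectorField_preimage (n := ω) (hX.contMDiffAt (hO.mem_nhds hyO))
    (contMDiffAt_extChartAt_symm_of_mem hy) (isInvertible_mfderiv_extChartAt_symm hy) (by simp)
  exact contMDiffAt_vectorSpace_iff_contDiffAt.1 h1

theorem contDiffAt_comp_extChartAt_symm {x₀ : M} {O : Set M} (hO : IsOpen O) {f : M → ℝ}
    (hf : AnalyticFun (N := N) O f) {y : EuclideanSpace ℝ (Fin N)}
    (hy : y ∈ (extChartAt (𝓡 N) x₀).target) (hyO : (extChartAt (𝓡 N) x₀).symm y ∈ O) :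
    ContDiffAt ℝ ω (fun y => f ((extChartAt (𝓡 N) x₀).symm y)) y :=
  (ContMDiffAt.comp y (hf.contMDiffAt (hO.mem_nhds hyO))
    (contMDiffAt_extChartAt_symm_of_mem hy)).contDiffAt

/-- The bracket is natural under pullback by the inverse chart, and in a vector space it is the
difference of directional derivatives. -/
theorem chartField_mlieBracket {x₀ : M} {O : Set M} (hO : IsOpen O) {X Y : VField N M}
    (hX : AnalyticVF O X) (hY : AnalyticVF O Y) {y : EuclideanSpace ℝ (Fin N)}
    (hy : y ∈ (extChartAt (𝓡 N) x₀).target) (hyO : (extChartAt (𝓡 N) x₀).symm y ∈ O) :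
    chartField x₀ (VectorField.mlieBracket (𝓡 N) X Y) y =
      fderiv ℝ (chartField x₀ Y) y (chartField x₀ X y) -
        fderiv ℝ (chartField x₀ X) y (chartField x₀ Y y) := by
  have h1 := VectorField.mpullback_mlieBracket (n := ω) (I := 𝓘(ℝ, EuclideanSpace ℝ (Fin N)))
    ((hX.contMDiffAt (hO.mem_nhds hyO)).mdifferentiableAt (by simp))
    ((hY.contMDiffAt (hO.mem_nhds hyO)).mdifferentiableAt (by simp))
    (contMDiffAt_extChartAt_symm_of_mem hy) (by simp)
  have h2 := VectorField.mlieBracketWithin_eq_lieBracketWithin (𝕜 := ℝ)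
    (V := chartField x₀ X) (W := chartField x₀ Y) (s := univ)
  rw [VectorField.lieBracketWithin_univ] at h2
  exact h1.trans (congrFun ((VectorField.mlieBracketWithin_univ (V := chartField x₀ X)
    (W := chartField x₀ Y)).symm.trans h2) y)

theorem linearIndependent_chartField_iff {κ : Type*} {x₀ : M} (X : κ → VField N M)
    {y : EuclideanSpace ℝ (Fin N)} (hy : y ∈ (extChartAt (𝓡 N) x₀).target) :
    LinearIndependent ℝ (fun i => chartField x₀ (X i) y) ↔
      LinearIndependent ℝ (fun i => X i ((extChartAt (𝓡 N) x₀).symm y)) := by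
  obtain ⟨e, he⟩ := isInvertible_mfderiv_extChartAt_symm hy
  have h1 : (fun i => X i ((extChartAt (𝓡 N) x₀).symm y)) =
      e.toLinearEquiv.toLinearMap ∘ fun i => chartField x₀ (X i) y := by
    funext i
    rw [← mfderiv_extChartAt_symm_chartField (X i) hy, ← he]
    rfl
  rw [h1]
  exact (LinearMap.linearIndependent_iff_of_injOn e.toLinearEquiv.toLinearMap
    e.injective.injOn).symm

/-- Analytic vector fields on a connected open set which are linearly independent at one point are
linearly independent on an open dense subset. -/
theorem linearIndependent_open_dense {κ : Type*} [Fintype κ] {U : Set M} (hU : IsOpen U)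
    (hUc : IsPreconnected U) {X : κ → VField N M} (hX : ∀ i, AnalyticVF U (X i)) {x₁ : M}
    (hx₁ : x₁ ∈ U) (h₁ : LinearIndependent ℝ (fun i => X i x₁)) :
    ∃ G : Set M, IsOpen G ∧ G ⊆ U ∧ U ⊆ closure G ∧
      ∀ x ∈ G, LinearIndependent ℝ (fun i => X i x) := by
  classical
  let G : Set M := {x | x ∈ U ∧ LinearIndependent ℝ (fun i => X i x)}
  -- The Gram determinant turns linear independence into the nonvanishing of one analytic function
  -- in each chart.
  let h : M → EuclideanSpace ℝ (Fin N) → ℝ := fun x₀ y =>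
    (Matrix.gram ℝ fun i => chartField x₀ (X i) y).det
  have hG : ∀ {x₀ : M} {y : EuclideanSpace ℝ (Fin N)}, y ∈ (extChartAt (𝓡 N) x₀).target →
      (extChartAt (𝓡 N) x₀).symm y ∈ U → (h x₀ y ≠ 0 ↔ (extChartAt (𝓡 N) x₀).symm y ∈ G) := by
    intro x₀ y hy hyU
    have h1 := (linearIndependent_chartField_iff X hy)
    simp only [G, mem_ofPred_eq, hyU, true_and, ← h1, h,
      Matrix.det_gram_ne_zero_iff_linearIndependent]
  have hh : ∀ {x₀ : M} {y : EuclideanSpace ℝ (Fin N)}, y ∈ (extChartAt (𝓡 N) x₀).target →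
      (extChartAt (𝓡 N) x₀).symm y ∈ U → ContDiffAt ℝ ω (h x₀) y := by
    intro x₀ y hy hyU
    simp only [h, Matrix.det_apply]
    refine ContDiffAt.sum fun σ _ => ContDiffAt.const_smul _ (contDiffAt_prod fun i _ => ?_)
    exact (contDiffAt_chartField hU (hX _) hy hyU).inner ℝ (contDiffAt_chartField hU (hX _) hy hyU)
  refine ⟨G, ?_, fun x hx => hx.1, ?_, fun x hx => hx.2⟩
  · rw [isOpen_iff_mem_nhds]
    intro x hx
    have hy := mem_extChartAt_target (I := 𝓡 N) x
    have hyU : (extChartAt (𝓡 N) x).symm (extChartAt (𝓡 N) x x) ∈ U := by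
      rw [extChartAt_to_inv]; exact hx.1
    have h1 : h x (extChartAt (𝓡 N) x x) ≠ 0 := by
      rw [hG hy hyU, extChartAt_to_inv]; exact hx
    have h2 : ∀ᶠ y in 𝓝 (extChartAt (𝓡 N) x x), h x y ≠ 0 :=
      (hh hy hyU).continuousAt.eventually_ne h1
    filter_upwards [(continuousAt_extChartAt (I := 𝓡 N) x).eventually h2,
      extChartAt_source_mem_nhds (I := 𝓡 N) x, hU.mem_nhds hx.1] with z hz hzs hzU
    have h3 := (extChartAt (𝓡 N) x).left_inv hzs
    have h4 := (hG ((extChartAt (𝓡 N) x).map_source hzs) (by rwa [h3])).1 hz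
    rwa [h3] at h4
  · by_contra hcon
    obtain ⟨z, hzU, hz⟩ := not_subset.1 hcon
    -- The part of `U` outside the closure of `G` is relatively open and, by the identity theorem
    -- for `h` on a chart ball, relatively closed. If it were nonempty it would be all of the
    -- connected set `U`, although `x₁ ∈ G`.
    have hsub : U ⊆ (closure G)ᶜ := by
      refine hUc.subset_of_closure_inter_subset isClosed_closure.isOpen_compl ⟨z, hzU, hz⟩ ?_
      rintro x ⟨hxc, hxU⟩
      set φ := extChartAt (𝓡 N) x with hφ
      have hy := mem_extChartAt_target (I := 𝓡 N) x
      have hyU : φ.symm (φ x) ∈ U := by rw [hφ, extChartAt_to_inv]; exact hxU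
      obtain ⟨r, hr, hball⟩ := Metric.mem_nhds_iff.1
        (inter_mem (extChartAt_target_mem_nhds hy) (extChartAt_symm_preimage_mem_nhds hU hy hyU))
      have hnhd : φ.source ∩ φ ⁻¹' Metric.ball (φ x) r ∈ 𝓝 x :=
        inter_mem (extChartAt_source_mem_nhds x)
          ((continuousAt_extChartAt x).preimage_mem_nhds (Metric.ball_mem_nhds _ hr))
      obtain ⟨z', ⟨hz's, hz'b⟩, hz'⟩ := mem_closure_iff_nhds.1 hxc _ hnhd
      have hlz : φ.symm (φ z') = z' := φ.left_inv hz's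
      have hev : h x =ᶠ[𝓝 (φ z')] 0 := by
        have h1 : (closure G)ᶜ ∈ 𝓝 (φ.symm (φ z')) := by
          rw [hlz]; exact isClosed_closure.isOpen_compl.mem_nhds hz'
        have h2 := (continuousAt_extChartAt_symm'' (φ.map_source hz's)).preimage_mem_nhds h1
        filter_upwards [h2, Metric.isOpen_ball.mem_nhds hz'b] with y hy1 hy2
        by_contra hne
        exact hy1 (subset_closure ((hG (hball hy2).1 (hball hy2).2).1 hne))
      have hzero := AnalyticOnNhd.eqOn_zero_of_preconnected_of_eventuallyEq_zero
        (fun y hy => (hh (hball hy).1 (hball hy).2).analyticAt)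
        (convex_ball (φ x) r).isPreconnected hz'b hev
      intro hxG
      obtain ⟨w, ⟨hws, hwb⟩, hw⟩ := mem_closure_iff_nhds.1 hxG _ hnhd
      have hlw : φ.symm (φ w) = w := φ.left_inv hws
      have h3 := (hG (hball hwb).1 (hball hwb).2).2 (by
        have : φ.symm (φ w) ∈ G := by rw [hlw]; exact hw
        exact this)
      exact h3 (hzero hwb)
    exact hsub hx₁ (subset_closure ⟨hx₁, h₁⟩)

end Charts

/-! ### Uniqueness of integral curves and of fundamental solutions on the manifold -/

section IntegralCurves

variable {N : ℕ} {M : Type*} [TopologicalSpace M] [ChartedSpace (EuclideanSpace ℝ (Fin N)) M]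

variable [IsManifold (𝓡 N) ω M]

theorem AnalyticVF.mono {O O' : Set M} {X : VField N M} (h : AnalyticVF O X) (hO : O' ⊆ O) :
    AnalyticVF O' X := ContMDiffOn.mono h hO

theorem AnalyticVF.smul {O : Set M} {f : M → ℝ} {X : VField N M}
    (hf : AnalyticFun (N := N) O f) (hX : AnalyticVF O X) : AnalyticVF O (fun x => f x • X x) :=
  ContMDiffOn.smul_section hf hX

theorem AnalyticVF.sum {ι : Type*} [Fintype ι] {O : Set M} {X : ι → VField N M}
    (hX : ∀ i, AnalyticVF O (X i)) : AnalyticVF O (fun x => ∑ i, X i x) :=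
  ContMDiffOn.sum_section fun i _ => hX i

theorem hasDerivWithinAt_extChartAt_comp {x₀ : M} {T : VField N M} {γ : ℝ → M} {s : Set ℝ} {v : ℝ}
    (hγ : IsMIntegralCurveOn γ T s) (hv : v ∈ s) (hsrc : γ v ∈ (extChartAt (𝓡 N) x₀).source) :
    HasDerivWithinAt (fun u => extChartAt (𝓡 N) x₀ (γ u))
      (chartField x₀ T (extChartAt (𝓡 N) x₀ (γ v))) s v := by
  have h1 : MDifferentiableAt (𝓡 N) 𝓘(ℝ, EuclideanSpace ℝ (Fin N)) (extChartAt (𝓡 N) x₀) (γ v) :=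
    (contMDiffAt_extChartAt' (n := ω) (by rwa [extChartAt_source] at hsrc)).mdifferentiableAt
      (by simp)
  have h2 := HasMFDerivAt.comp_hasMFDerivWithinAt v h1.hasMFDerivAt (hγ v hv)
  rw [hasDerivWithinAt_iff_hasFDerivWithinAt]
  refine hasMFDerivWithinAt_iff_hasFDerivWithinAt.1 (h2.congr_mfderiv ?_)
  ext1
  change mfderiv (𝓡 N) 𝓘(ℝ, EuclideanSpace ℝ (Fin N)) (extChartAt (𝓡 N) x₀) (γ v)
    ((1 : ℝ) • T (γ v)) = (1 : ℝ) • chartField x₀ T (extChartAt (𝓡 N) x₀ (γ v))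
  rw [one_smul, one_smul]
  exact mfderiv_extChartAt_eq_chartField T hsrc

theorem hasMFDerivAt_extChartAt_symm_comp {x₀ : M} {T : VField N M}
    {c : ℝ → EuclideanSpace ℝ (Fin N)} {t : ℝ} (hc : HasDerivAt c (chartField x₀ T (c t)) t)
    (ht : c t ∈ (extChartAt (𝓡 N) x₀).target) :
    HasMFDerivAt 𝓘(ℝ, ℝ) (𝓡 N) (fun u => (extChartAt (𝓡 N) x₀).symm (c u)) t
      ((1 : ℝ →L[ℝ] ℝ).smulRight (T ((extChartAt (𝓡 N) x₀).symm (c t)))) := by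
  have h1 := ((contMDiffAt_extChartAt_symm_of_mem ht).mdifferentiableAt (by simp)).hasMFDerivAt
  have h2 := HasMFDerivAt.comp t h1 hc.hasFDerivAt.hasMFDerivAt
  refine h2.congr_mfderiv ?_
  ext
  change mfderiv 𝓘(ℝ, EuclideanSpace ℝ (Fin N)) (𝓡 N) (extChartAt (𝓡 N) x₀).symm (c t)
    ((1 : ℝ) • chartField x₀ T (c t)) = (1 : ℝ) • T ((extChartAt (𝓡 N) x₀).symm (c t))
  rw [one_smul, one_smul]
  exact mfderiv_extChartAt_symm_chartField T ht

/-- Integral curves of an analytic vector field with the same starting point agree. -/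
theorem integralCurve_eqOn [T2Space M] {V : Set M} (hV : IsOpen V) {T : VField N M}
    (hT : AnalyticVF V T) {γ₁ γ₂ : ℝ → M} {b : ℝ} (h₁ : IsMIntegralCurveOn γ₁ T (Icc 0 b))
    (h₂ : IsMIntegralCurveOn γ₂ T (Icc 0 b)) (hV₁ : ∀ s ∈ Icc 0 b, γ₁ s ∈ V)
    (h0 : γ₁ 0 = γ₂ 0) : EqOn γ₁ γ₂ (Icc 0 b) := by
  have hc₁ : ContinuousOn γ₁ (Icc 0 b) := fun s hs => (h₁ s hs).continuousWithinAt
  have hc₂ : ContinuousOn γ₂ (Icc 0 b) := fun s hs => (h₂ s hs).continuousWithinAt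
  -- Continuous induction: the set of agreement is closed because `M` is Hausdorff, and it extends
  -- to the right of each of its points by uniqueness for the Lipschitz equation in a chart.
  refine IsClosed.Icc_subset_of_forall_mem_nhdsWithin (s := {u | γ₁ u = γ₂ u}) ?_ h0 ?_
  · have := (hc₁.prodMk hc₂).preimage_isClosed_of_isClosed isClosed_Icc isClosed_diagonal
    rw [inter_comm]
    exact this
  · rintro u ⟨hu, hub⟩
    have huI : u ∈ Icc 0 b := Ico_subset_Icc_self hub
    set φ := extChartAt (𝓡 N) (γ₁ u) with hφ
    have hy : φ (γ₁ u) ∈ φ.target := mem_extChartAt_target _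
    have hyV : φ.symm (φ (γ₁ u)) ∈ V := by rw [hφ, extChartAt_to_inv]; exact hV₁ u huI
    obtain ⟨K, S, hS, hlip⟩ :=
      ((contDiffAt_chartField hV hT hy hyV).of_le (m := 1) (by simp)).exists_lipschitzOnWith
    have hnhd : ∀ᶠ x in 𝓝 (γ₁ u), x ∈ φ.source ∧ φ x ∈ S :=
      Filter.Eventually.and (extChartAt_source_mem_nhds (I := 𝓡 N) (γ₁ u))
        ((continuousAt_extChartAt (γ₁ u)).eventually hS)
    have hle : 𝓝[≥] u ≤ 𝓝[Icc 0 b] u :=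
      nhdsWithin_le_iff.2 (mem_of_superset (Icc_mem_nhdsGE hub.2) (Icc_subset_Icc_left hub.1))
    have e₁ : ∀ᶠ v in 𝓝[≥] u, γ₁ v ∈ φ.source ∧ φ (γ₁ v) ∈ S :=
      ((hc₁ u huI).mono_left hle).eventually hnhd
    have e₂ : ∀ᶠ v in 𝓝[≥] u, γ₂ v ∈ φ.source ∧ φ (γ₂ v) ∈ S := by
      have h := hnhd
      rw [show γ₁ u = γ₂ u from hu] at h
      exact ((hc₂ u huI).mono_left hle).eventually h
    have e₃ : ∀ᶠ v in 𝓝[≥] u, v ∈ Icc u b := Icc_mem_nhdsGE hub.2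
    obtain ⟨w, hw, hwS⟩ := (mem_nhdsGE_iff_exists_Icc_subset).1 (e₁.and (e₂.and e₃))
    have hsub : Icc u w ⊆ Icc 0 b := fun v hv =>
      ⟨hub.1.trans (hwS hv).2.2.1, (hwS hv).2.2.2⟩
    have hwb : w ≤ b := (hwS (right_mem_Icc.2 (le_of_lt hw))).2.2.2
    have hd : ∀ γ : ℝ → M, IsMIntegralCurveOn γ T (Icc 0 b) → (∀ v ∈ Icc u w, γ v ∈ φ.source) →
        ContinuousOn (fun v => φ (γ v)) (Icc u w) ∧ ∀ v ∈ Ico u w,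
          HasDerivWithinAt (fun v => φ (γ v)) (chartField (γ₁ u) T (φ (γ v))) (Ici v) v := by
      intro γ hγ hs
      have h3 : ∀ v ∈ Icc u w, HasDerivWithinAt (fun v => φ (γ v))
          (chartField (γ₁ u) T (φ (γ v))) (Icc 0 b) v := fun v hv =>
        hasDerivWithinAt_extChartAt_comp hγ (hsub hv) (hs v hv)
      refine ⟨fun v hv => (h3 v hv).continuousWithinAt.mono hsub, fun v hv => ?_⟩
      refine (h3 v (Ico_subset_Icc_self hv)).mono_of_mem_nhdsWithin ?_
      exact mem_of_superset (Icc_mem_nhdsGE (hv.2.trans_le hwb))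
        (Icc_subset_Icc_left (hub.1.trans hv.1))
    obtain ⟨k₁, k₁'⟩ := hd γ₁ h₁ fun v hv => (hwS hv).1.1
    obtain ⟨k₂, k₂'⟩ := hd γ₂ h₂ fun v hv => (hwS hv).2.1.1
    have hEq := ODE_solution_unique_of_mem_Icc_right (v := fun _ => chartField (γ₁ u) T)
      (s := fun _ => S) (fun _ _ => hlip) k₁ k₁'
      (fun v hv => (hwS (Ico_subset_Icc_self hv)).1.2) k₂ k₂'
      (fun v hv => (hwS (Ico_subset_Icc_self hv)).2.1.2) (congrArg φ hu)
    refine mem_of_superset (Icc_mem_nhdsGT (show u < w from hw)) fun v hv => ?_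
    exact φ.injOn (hwS hv).1.1 (hwS hv).2.1.1 (hEq hv)

/-- Integral curves, in both directions of time, with the same starting point agree. -/
theorem integralCurve_eqOn_uIcc [T2Space M] {V : Set M} (hV : IsOpen V) {T : VField N M}
    (hT : AnalyticVF V T) {γ₁ γ₂ : ℝ → M} {t : ℝ} (h₁ : IsMIntegralCurveOn γ₁ T (uIcc 0 t))
    (h₂ : IsMIntegralCurveOn γ₂ T (uIcc 0 t)) (hV₁ : ∀ s ∈ uIcc 0 t, γ₁ s ∈ V)
    (h0 : γ₁ 0 = γ₂ 0) : EqOn γ₁ γ₂ (uIcc 0 t) := by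
  rcases le_total 0 t with h | h
  · rw [uIcc_of_le h] at *
    exact integralCurve_eqOn hV hT h₁ h₂ hV₁ h0
  · rw [uIcc_of_ge h] at *
    have hsub : Icc 0 (-t) ⊆ {s | s * (-1) ∈ Icc t 0} := fun s hs => by
      rw [mem_ofPred_eq, mul_neg_one, mem_Icc]
      constructor <;> linarith [hs.1, hs.2]
    -- Negative times reduce to positive ones for the field `-T`.
    have hT' : AnalyticVF V ((-1 : ℝ) • T) := AnalyticVF.smul (f := fun _ => -1) contMDiffOn_const hT
    have key := integralCurve_eqOn hV hT' ((h₁.comp_mul (-1)).mono hsub)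
      ((h₂.comp_mul (-1)).mono hsub) (fun s hs => hV₁ _ (hsub hs)) (by simpa using h0)
    intro s hs
    have := key (x := -s) ⟨by linarith [hs.2], by linarith [hs.1]⟩
    simpa using this

theorem FlowsTo.unique [T2Space M] {V : Set M} (hV : IsOpen V) {T : VField N M}
    (hT : AnalyticVF V T) {t : ℝ} {x y₁ y₂ : M} (h₁ : FlowsTo V T t x y₁)
    (h₂ : FlowsTo V T t x y₂) : y₁ = y₂ := by
  obtain ⟨γ₁, a₁, b₁, c₁, d₁⟩ := h₁
  obtain ⟨γ₂, a₂, -, c₂, d₂⟩ := h₂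
  rw [← d₁, ← d₂]
  exact integralCurve_eqOn_uIcc hV hT a₁ a₂ b₁ (c₁.trans c₂.symm) right_mem_uIcc

/-- Uniqueness removes the arbitrary choice in `flow`. -/
theorem FlowsTo.flow_eq [T2Space M] {V : Set M} (hV : IsOpen V) {T : VField N M}
    (hT : AnalyticVF V T) {t : ℝ} {x y : M} (h : FlowsTo V T t x y) : flow V T t x = y := by
  have hex : ∃ y, FlowsTo V T t x y := ⟨y, h⟩
  rw [flow, dif_pos hex]
  exact FlowsTo.unique hV hT hex.choose_spec h

variable {ι : Type} [Fintype ι] [DecidableEq ι]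

/-- The fundamental solution of `e' = C e` along the integral curve of `T` which starts from `x`
exists up to time `t` and is then equal to `m`. -/
def Transports (V : Set M) (T : VField N M) (C : ι → ι → M → ℝ) (t : ℝ) (x : M)
    (m : ι → ι → ℝ) : Prop :=
  ∃ γ : ℝ → M, IsMIntegralCurveOn γ T (uIcc 0 t) ∧ (∀ s ∈ uIcc 0 t, γ s ∈ V) ∧ γ 0 = x ∧
    ∃ e : ℝ → ι → ι → ℝ, (∀ A B, e 0 A B = if A = B then 1 else 0) ∧ e t = m ∧
      ∀ s ∈ uIcc 0 t, ∀ A B,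
        HasDerivWithinAt (fun u => e u A B) (∑ D, C A D (γ s) * e s D B) (uIcc 0 t) s

/-- Grönwall's inequality for functions which are controlled only on the closed interval between `0`
and `t`, as the solutions in `Transports` are. -/
theorem eq_zero_of_norm_derivWithin_le {G : Type*} [NormedAddCommGroup G] [NormedSpace ℝ G]
    {r r' : ℝ → G} {K t : ℝ} (hr : ∀ s ∈ uIcc 0 t, HasDerivWithinAt r (r' s) (uIcc 0 t) s)
    (hK : ∀ s ∈ uIcc 0 t, ‖r' s‖ ≤ K * ‖r s‖) (h0 : r 0 = 0) : r t = 0 := by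
  have key : ∀ (t : ℝ) (ρ ρ' : ℝ → G), 0 ≤ t →
      (∀ s ∈ Icc 0 t, HasDerivWithinAt ρ (ρ' s) (Icc 0 t) s) →
      (∀ s ∈ Icc 0 t, ‖ρ' s‖ ≤ K * ‖ρ s‖) → ρ 0 = 0 → ρ t = 0 := by
    intro t ρ ρ' ht h1 h2 h3
    refine eq_zero_of_abs_deriv_le_mul_abs_self_of_eq_zero_right (f := ρ) (f' := ρ') (K := K)
      (a := 0) (b := t) (fun s hs => (h1 s hs).continuousWithinAt) (fun s hs => ?_) h3
      (fun s hs => h2 s (Ico_subset_Icc_self hs)) t ⟨ht, le_rfl⟩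
    exact (h1 s (Ico_subset_Icc_self hs)).mono_of_mem_nhdsWithin
      (mem_of_superset (Icc_mem_nhdsGE hs.2) (Icc_subset_Icc_left hs.1))
  rcases le_total 0 t with h | h
  · rw [uIcc_of_le h] at hr hK
    exact key t r r' h hr hK h0
  · rw [uIcc_of_ge h] at hr hK
    have hmap : MapsTo (fun s : ℝ => -s) (Icc 0 (-t)) (Icc t 0) := fun s hs =>
      ⟨by linarith [hs.2], by linarith [hs.1]⟩
    have := key (-t) (fun s => r (-s)) (fun s => -r' (-s)) (by linarith)
      (fun s hs => by
        have h1 := (hr (-s) (hmap hs)).scomp s (hasDerivAt_neg s).hasDerivWithinAt hmap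
        simpa [Function.comp_def] using h1)
      (fun s hs => by rw [norm_neg]; exact hK (-s) (hmap hs)) (by simpa using h0)
    simpa using this

/-- The two integral curves agree, `C` is bounded along this compact curve, and Grönwall's
inequality applies to the difference of the solutions. Hence the value does not depend on the chart
in which a solution is constructed. -/
theorem Transports.unique [T2Space M] {V : Set M} (hV : IsOpen V) {T : VField N M}
    (hT : AnalyticVF V T) {C : ι → ι → M → ℝ} (hC : ∀ A B, ContinuousOn (C A B) V) {t : ℝ} {x : M}
    {m₁ m₂ : ι → ι → ℝ} (h₁ : Transports V T C t x m₁) (h₂ : Transports V T C t x m₂) :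
    m₁ = m₂ := by
  obtain ⟨γ₁, a₁, b₁, c₁, e₁, z₁, d₁, f₁⟩ := h₁
  obtain ⟨γ₂, a₂, b₂, c₂, e₂, z₂, d₂, f₂⟩ := h₂
  have hγ := integralCurve_eqOn_uIcc hV hT a₁ a₂ b₁ (c₁.trans c₂.symm)
  have hc₁ : ContinuousOn γ₁ (uIcc 0 t) := fun s hs => (a₁ s hs).continuousWithinAt
  have hbd : ∀ A D, ∃ k : ℝ, ∀ s ∈ uIcc 0 t, ‖C A D (γ₁ s)‖ ≤ k := fun A D =>
    isCompact_uIcc.exists_bound_of_continuousOn ((hC A D).comp hc₁ b₁)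
  choose k hk using hbd
  have hk0 : ∀ A D, 0 ≤ k A D := fun A D => (norm_nonneg _).trans (hk A D 0 left_mem_uIcc)
  set K : ℝ := ∑ A, ∑ D, k A D
  have hrow : ∀ A, ∑ D, k A D ≤ K := fun A =>
    Finset.single_le_sum (f := fun A => ∑ D, k A D)
      (fun A _ => Finset.sum_nonneg fun D _ => hk0 A D) (Finset.mem_univ A)
  have hK0 : 0 ≤ K := Finset.sum_nonneg fun A _ => Finset.sum_nonneg fun D _ => hk0 A D
  have hz := eq_zero_of_norm_derivWithin_le (r := fun s => e₁ s - e₂ s)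
    (r' := fun s A B => ∑ D, C A D (γ₁ s) * (e₁ s - e₂ s) D B) (K := K) (t := t)
    (fun s hs => by
      rw [hasDerivWithinAt_pi]
      intro A
      rw [hasDerivWithinAt_pi]
      intro B
      have h3 := f₂ s hs A B
      rw [← hγ hs] at h3
      refine ((f₁ s hs A B).sub h3).congr_deriv ?_
      simp only [Pi.sub_apply, mul_sub, Finset.sum_sub_distrib])
    (fun s hs => by
      rw [pi_norm_le_iff_of_nonneg (by positivity)]
      intro A
      rw [pi_norm_le_iff_of_nonneg (by positivity)]
      intro B
      refine (norm_sum_le _ _).trans ?_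
      refine le_trans ?_ (mul_le_mul_of_nonneg_right (hrow A) (norm_nonneg _))
      rw [Finset.sum_mul]
      refine Finset.sum_le_sum fun D _ => ?_
      rw [norm_mul]
      exact mul_le_mul (hk A D s hs) ((norm_le_pi_norm _ B).trans (norm_le_pi_norm _ D))
        (norm_nonneg _) (hk0 A D))
    (by ext A B; simp [z₁, z₂])
  rw [← d₁, ← d₂]
  exact sub_eq_zero.1 hz

end IntegralCurves

/-! ### Push-forwards by the flow, near a point of the manifold -/

section LocalTransport

variable {N : ℕ} {M : Type*} [TopologicalSpace M] [ChartedSpace (EuclideanSpace ℝ (Fin N)) M]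
  [IsManifold (𝓡 N) ω M] {ι : Type} [Fintype ι] [DecidableEq ι]

omit [DecidableEq ι] in
/-- The bracket relation `[T, W_A] = ∑ C_AB W_B` in a chart. -/
theorem fderiv_chartField_bracket {V : Set M} (hV : IsOpen V) {T : VField N M}
    (hT : AnalyticVF V T) {C : ι → ι → M → ℝ} {W : ι → VField N M} (hW : ∀ A, AnalyticVF V (W A))
    (hbr : ∀ x ∈ V, ∀ A, VectorField.mlieBracket (𝓡 N) T (W A) x = ∑ B, C A B x • W B x)
    {x₀ : M} {y : EuclideanSpace ℝ (Fin N)} (hy : y ∈ (extChartAt (𝓡 N) x₀).target)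
    (hyV : (extChartAt (𝓡 N) x₀).symm y ∈ V) (A : ι) :
    fderiv ℝ (chartField x₀ (W A)) y (chartField x₀ T y) =
      fderiv ℝ (chartField x₀ T) y (chartField x₀ (W A) y) +
        ∑ B, C A B ((extChartAt (𝓡 N) x₀).symm y) • chartField x₀ (W B) y := by
  have h1 := chartField_mlieBracket hV hT (hW A) hy hyV
  have h2 := chartField_congr (X := VectorField.mlieBracket (𝓡 N) T (W A))
    (Y := fun x => ∑ B, C A B x • W B x) (hbr _ hyV A)
  rw [h2, chartField_sum] at h1
  rw [h1]
  abel

/-- The push-forward of the fields `W_A` by a flow which in a chart is given by `ψ`. -/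
theorem pushforward_eq_of_isLocalTransport [T2Space M] {V : Set M} (hV : IsOpen V) {T : VField N M}
    (hT : AnalyticVF V T) {C : ι → ι → EuclideanSpace ℝ (Fin N) → ℝ} {W : ι → VField N M} {x₀ : M}
    {ψ : EuclideanSpace ℝ (Fin N) × ℝ → EuclideanSpace ℝ (Fin N)}
    {e : EuclideanSpace ℝ (Fin N) × ℝ → ι → ι → ℝ} {δ r t : ℝ}
    (H : IsLocalTransport (chartField x₀ T) C (fun A => chartField x₀ (W A)) ψ e
      (extChartAt (𝓡 N) x₀ x₀) δ) (hrδ : r ≤ δ)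
    (hflow : ∀ x ∈ (extChartAt (𝓡 N) x₀).source,
      extChartAt (𝓡 N) x₀ x ∈ Metric.ball (extChartAt (𝓡 N) x₀ x₀) r → ∀ t, |t| < r →
      FlowsTo V T t x ((extChartAt (𝓡 N) x₀).symm (ψ (extChartAt (𝓡 N) x₀ x, t))))
    {x : M} (hx : x ∈ (extChartAt (𝓡 N) x₀).source)
    (hxr : extChartAt (𝓡 N) x₀ x ∈ Metric.ball (extChartAt (𝓡 N) x₀ x₀) r) (ht : |t| < r)
    (hp : ψ (extChartAt (𝓡 N) x₀ x, -t) ∈ Metric.ball (extChartAt (𝓡 N) x₀ x₀) r)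
    (hpt : ψ (extChartAt (𝓡 N) x₀ x, -t) ∈ (extChartAt (𝓡 N) x₀).target) (A : ι) :
    pushforward V T t (W A) x = ∑ B, e (extChartAt (𝓡 N) x₀ x, -t) A B • W B x := by
  set φ := extChartAt (𝓡 N) x₀ with hφ
  set y := φ x with hy
  set y₁ := ψ (y, -t) with hy₁
  have ht' : |-t| < r := by rwa [abs_neg]
  have hyt : y ∈ φ.target := φ.map_source hx
  set p := φ.symm y₁ with hpdef
  have hps : p ∈ φ.source := φ.map_target hpt
  have hφp : φ p = y₁ := φ.right_inv hpt
  have hflowx : flow V T (-t) x = p := (hflow x hx hxr (-t) ht').flow_eq hV hT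
  have hinv : ψ (y₁, t) = y := H.inverse y (Metric.ball_subset_ball hrδ hxr) t (ht.trans_le hrδ)
  -- The differential of the flow at `p` needs the chart formula on a whole neighbourhood of `p`,
  -- not only at `p`.
  have hflowp : flow V T t =ᶠ[𝓝 p] fun z => φ.symm (ψ (φ z, t)) := by
    have h1 : ∀ᶠ z in 𝓝 p, φ z ∈ Metric.ball (φ x₀) r := by
      refine (continuousAt_extChartAt' hps).eventually (Metric.isOpen_ball.mem_nhds ?_)
      rw [← hφ, hφp]; exact hp
    filter_upwards [h1, extChartAt_source_mem_nhds' hps] with z hz hzs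
    exact (hflow z hzs hz t ht).flow_eq hV hT
  have hψ1 : DifferentiableAt ℝ (fun u => ψ (u, t)) y₁ :=
    DifferentiableAt.comp (g := ψ) y₁
      ((H.analytic_flow y₁ (Metric.ball_subset_ball hrδ hp) t (ht.trans_le hrδ)).differentiableAt
        (by simp)) (by fun_prop)
  have hψ2 : DifferentiableAt ℝ (fun u => ψ (u, -t)) y :=
    DifferentiableAt.comp (g := ψ) y
      ((H.analytic_flow y (Metric.ball_subset_ball hrδ hxr) (-t)
        (ht'.trans_le hrδ)).differentiableAt (by simp)) (by fun_prop)
  -- Differentiating `ψ_t ∘ ψ_{-t} = id` at `y`.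
  have hid : ∀ v, fderiv ℝ (fun u => ψ (u, t)) y₁ (fderiv ℝ (fun u => ψ (u, -t)) y v) = v := by
    intro v
    have h1 : HasFDerivAt (fun u => ψ (ψ (u, -t), t))
        ((fderiv ℝ (fun u => ψ (u, t)) y₁).comp (fderiv ℝ (fun u => ψ (u, -t)) y)) y :=
      HasFDerivAt.comp (g := fun u => ψ (u, t)) y hψ1.hasFDerivAt hψ2.hasFDerivAt
    have h2 : (fun u => ψ (ψ (u, -t), t)) =ᶠ[𝓝 y] id := by
      filter_upwards [Metric.isOpen_ball.mem_nhds hxr] with u hu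
      exact H.inverse u (Metric.ball_subset_ball hrδ hu) t (ht.trans_le hrδ)
    have h3 := h1.unique ((hasFDerivAt_id y).congr_of_eventuallyEq h2)
    exact DFunLike.congr_fun h3 v
  have hd1 : HasMFDerivAt (𝓡 N) 𝓘(ℝ, EuclideanSpace ℝ (Fin N)) φ p
      (mfderiv (𝓡 N) 𝓘(ℝ, EuclideanSpace ℝ (Fin N)) φ p) :=
    ((contMDiffAt_extChartAt' (n := ω)
      (by rwa [hφ, extChartAt_source] at hps)).mdifferentiableAt (by simp)).hasMFDerivAt
  have hd2 : HasMFDerivAt 𝓘(ℝ, EuclideanSpace ℝ (Fin N)) 𝓘(ℝ, EuclideanSpace ℝ (Fin N))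
      (fun u => ψ (u, t)) (φ p) (fderiv ℝ (fun u => ψ (u, t)) y₁) := by
    rw [hφp]; exact hψ1.hasFDerivAt.hasMFDerivAt
  have hd3 : HasMFDerivAt 𝓘(ℝ, EuclideanSpace ℝ (Fin N)) (𝓡 N) φ.symm (ψ (φ p, t))
      (mfderiv 𝓘(ℝ, EuclideanSpace ℝ (Fin N)) (𝓡 N) φ.symm y) := by
    rw [hφp, hinv]
    exact ((contMDiffAt_extChartAt_symm_of_mem hyt).mdifferentiableAt (by simp)).hasMFDerivAt
  have hd4 := (hd3.comp p (hd2.comp p hd1)).congr_of_eventuallyEq hflowp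
  have hxy : φ.symm y = x := φ.left_inv hx
  -- At time `-t`, transport writes `W_A` at `Φ_{-t}(x)` as the image under `dψ_{-t}` of a
  -- combination of the `W_B` at `x`; then `dψ_t` undoes `dψ_{-t}`. This is why `e` is taken at
  -- `-t`.
  have htr := H.transport y (Metric.ball_subset_ball hrδ hxr) (-t) (ht'.trans_le hrδ) A
  have hW1 : mfderiv (𝓡 N) 𝓘(ℝ, EuclideanSpace ℝ (Fin N)) φ p (W A p) = chartField x₀ (W A) y₁ := by
    rw [← hφp]; exact mfderiv_extChartAt_eq_chartField (W A) hps
  have hsum := mfderiv_extChartAt_symm_chartField (x₀ := x₀) (fun z => ∑ B, e (y, -t) A B • W B z) hyt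
  rw [← hφ, hxy] at hsum
  rw [pushforward, hflowx]
  refine Eq.trans ?_ hsum
  rw [chartField_sum x₀ (fun B _ => e (y, -t) A B) W y, hd4.mfderiv]
  change mfderiv 𝓘(ℝ, EuclideanSpace ℝ (Fin N)) (𝓡 N) φ.symm y
    (fderiv ℝ (fun u => ψ (u, t)) y₁
      (mfderiv (𝓡 N) 𝓘(ℝ, EuclideanSpace ℝ (Fin N)) φ p (W A p))) = _
  congr 1
  exact (congrArg (fderiv ℝ (fun u => ψ (u, t)) y₁) (hW1.trans htr)).trans (hid _)

/-- Near each point the flow of `T`, the fundamental solutions along it and the push-forwards of the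
fields `W_A` exist for small times and depend analytically on the point. -/
theorem exists_local_transports [T2Space M] {V : Set M} (hV : IsOpen V) {T : VField N M}
    (hT : AnalyticVF V T) {C : ι → ι → M → ℝ} (hC : ∀ A B, AnalyticFun (N := N) V (C A B))
    {W : ι → VField N M} (hW : ∀ A, AnalyticVF V (W A))
    (hbr : ∀ x ∈ V, ∀ A, VectorField.mlieBracket (𝓡 N) T (W A) x = ∑ B, C A B x • W B x)
    {x₀ : M} (hx₀ : x₀ ∈ V) :
    ∃ (O : Set M) (r K : ℝ) (m : ℝ → M → ι → ι → ℝ) (z : ℝ → M → M),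
      IsOpen O ∧ x₀ ∈ O ∧ O ⊆ V ∧ 0 < r ∧ 0 ≤ K ∧
      (∀ t, |t| < r → ∀ x ∈ O, FlowsTo V T t x (z t x) ∧ z t x ∈ V ∧
        Transports V T C t x (m t x)) ∧
      (∀ t, |t| < r → ∀ A B, AnalyticFun (N := N) O (fun x => m t x A B)) ∧
      (∀ x ∈ O, ∀ A B, m 0 x A B = if A = B then 1 else 0) ∧
      (∀ t, |t| < r → ∀ x ∈ O, ∀ A B,
        HasDerivAt (fun s => m s x A B) (∑ D, C A D (z t x) * m t x D B) t ∧
          |∑ D, C A D (z t x) * m t x D B| ≤ K) ∧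
      ∀ t, |t| < r → ∀ x ∈ O, ∀ A, pushforward V T t (W A) x = ∑ B, m (-t) x A B • W B x := by
  set φ := extChartAt (𝓡 N) x₀ with hφ
  have hy₀ : φ x₀ ∈ φ.target := mem_extChartAt_target x₀
  have hsymm : φ.symm (φ x₀) = x₀ := extChartAt_to_inv x₀
  have hy₀V : φ.symm (φ x₀) ∈ V := by rw [hsymm]; exact hx₀
  have hΩ : φ.target ∩ φ.symm ⁻¹' V ∈ 𝓝 (φ x₀) :=
    inter_mem (extChartAt_target_mem_nhds hy₀) (extChartAt_symm_preimage_mem_nhds hV hy₀ hy₀V)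
  let C' : ι → ι → EuclideanSpace ℝ (Fin N) → ℝ := fun A B y => C A B (φ.symm y)
  have hC' : ∀ A B, ContDiffAt ℝ ω (C' A B) (φ x₀) := fun A B =>
    contDiffAt_comp_extChartAt_symm hV (hC A B) hy₀ hy₀V
  obtain ⟨ψ, e, δ, H⟩ := exists_isLocalTransport (C := C') (W := fun A => chartField x₀ (W A))
    (contDiffAt_chartField hV hT hy₀ hy₀V) hC' (fun A => contDiffAt_chartField hV (hW A) hy₀ hy₀V)
    (by
      filter_upwards [hΩ] with y hy A
      exact fderiv_chartField_bracket hV hT hW hbr hy.1 hy.2 A)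
  have hδ := H.pos
  have hball₀ : φ x₀ ∈ Metric.ball (φ x₀) δ := Metric.mem_ball_self hδ
  have hψ0 : ψ (φ x₀, 0) = φ x₀ := H.flow_zero _ hball₀
  have hψc : Tendsto ψ (𝓝 (φ x₀, 0)) (𝓝 (φ x₀)) := by
    have := (H.analytic_flow _ hball₀ 0 (by simpa using hδ)).continuousAt
    rwa [ContinuousAt, hψ0] at this
  let rhs : ι → ι → EuclideanSpace ℝ (Fin N) × ℝ → ℝ := fun A B q =>
    ∑ D, C' A D (ψ q) * e q D B
  have hrhs : ∀ A B, ContinuousAt (rhs A B) (φ x₀, 0) := by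
    intro A B
    refine tendsto_finsetSum _ fun D _ => ?_
    refine Filter.Tendsto.mul ?_ ?_
    · have h1 := (hC' A D).continuousAt.tendsto
      rw [hψ0]
      exact h1.comp hψc
    · have h1 := (H.analytic_coeff _ hball₀ 0 (by simpa using hδ))
      exact (contDiffAt_pi.1 (contDiffAt_pi.1 h1 D) B).continuousAt
  set K : ℝ := ∑ A, ∑ B, (|rhs A B (φ x₀, 0)| + 1)
  have hKle : ∀ A B, |rhs A B (φ x₀, 0)| + 1 ≤ K := by
    intro A B
    have h1 : |rhs A B (φ x₀, 0)| + 1 ≤ ∑ B, (|rhs A B (φ x₀, 0)| + 1) :=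
      Finset.single_le_sum (f := fun B => |rhs A B (φ x₀, 0)| + 1) (fun _ _ => by positivity)
        (Finset.mem_univ B)
    exact h1.trans (Finset.single_le_sum (f := fun A => ∑ B, (|rhs A B (φ x₀, 0)| + 1))
      (fun _ _ => by positivity) (Finset.mem_univ A))
  have hK0 : 0 ≤ K := by positivity
  have hev : ∀ᶠ q in 𝓝 (φ x₀, (0 : ℝ)), ψ q ∈ φ.target ∩ φ.symm ⁻¹' V ∧
      ∀ A B, |rhs A B q| ≤ K := by
    refine (hψc.eventually hΩ).and (eventually_all.2 fun A => eventually_all.2 fun B => ?_)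
    have h1 := (hrhs A B).abs.eventually_lt_const (u := |rhs A B (φ x₀, 0)| + 1) (by simp)
    filter_upwards [h1] with q hq
    exact hq.le.trans (hKle A B)
  obtain ⟨δ₁, hδ₁, h₁⟩ := Metric.eventually_nhds_iff.1 hev
  set δ₂ := min δ δ₁ with hδ₂
  have hδ₂pos : 0 < δ₂ := lt_min hδ hδ₁
  -- `δ₃` keeps the point `Φ_{-t}(x)`, where the differential of `Φ_t` is taken, inside the ball on
  -- which the chart formula for the flow holds.
  obtain ⟨δ₃, hδ₃, h₃⟩ := Metric.eventually_nhds_iff.1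
    (hψc.eventually (Metric.ball_mem_nhds (φ x₀) hδ₂pos))
  have hmem : ∀ {d : ℝ} {y : EuclideanSpace ℝ (Fin N)} {t : ℝ}, dist y (φ x₀) < d → |t| < d →
      dist (y, t) (φ x₀, 0) < d := by
    intro d y t hy ht
    rw [Prod.dist_eq]
    exact max_lt hy (by simpa using ht)
  have hΩ' : ∀ y ∈ Metric.ball (φ x₀) δ₂, ∀ t, |t| < δ₂ → ψ (y, t) ∈ φ.target ∩ φ.symm ⁻¹' V ∧
      ∀ A B, |rhs A B (y, t)| ≤ K := fun y hy t ht =>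
    h₁ (hmem (lt_of_lt_of_le hy (min_le_right _ _)) (ht.trans_le (min_le_right _ _)))
  have habs : ∀ {s t : ℝ}, s ∈ uIcc 0 t → |s| ≤ |t| := fun hs => by
    simpa using abs_sub_left_of_mem_uIcc hs
  have hcurve : ∀ x ∈ φ.source, φ x ∈ Metric.ball (φ x₀) δ₂ → ∀ t, |t| < δ₂ →
      IsMIntegralCurveOn (fun s => φ.symm (ψ (φ x, s))) T (uIcc 0 t) ∧
      (∀ s ∈ uIcc 0 t, φ.symm (ψ (φ x, s)) ∈ V) ∧ φ.symm (ψ (φ x, 0)) = x := by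
    intro x hx hxb t ht
    have hxδ : φ x ∈ Metric.ball (φ x₀) δ := Metric.ball_subset_ball (min_le_left _ _) hxb
    refine ⟨fun s hs => ?_, fun s hs => (hΩ' _ hxb s ((habs hs).trans_lt ht)).1.2, ?_⟩
    · have hsδ := (habs hs).trans_lt ht
      exact (hasMFDerivAt_extChartAt_symm_comp
        (H.deriv_flow _ hxδ s (hsδ.trans_le (min_le_left _ _)))
        (hΩ' _ hxb s hsδ).1.1).hasMFDerivWithinAt
    · rw [H.flow_zero _ hxδ, φ.left_inv hx]
  have hflow : ∀ x ∈ φ.source, φ x ∈ Metric.ball (φ x₀) δ₂ → ∀ t, |t| < δ₂ →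
      FlowsTo V T t x (φ.symm (ψ (φ x, t))) := by
    intro x hx hxb t ht
    obtain ⟨h1, h2, h3⟩ := hcurve x hx hxb t ht
    exact ⟨_, h1, h2, h3, rfl⟩
  set r := min δ₂ δ₃ with hr
  have hr₂ : r ≤ δ₂ := min_le_left _ _
  have hr₃ : r ≤ δ₃ := min_le_right _ _
  have hrδ : r ≤ δ := hr₂.trans (min_le_left _ _)
  have hrpos : 0 < r := lt_min hδ₂pos hδ₃
  refine ⟨φ.source ∩ φ ⁻¹' Metric.ball (φ x₀) r ∩ V, r, K, fun t x => e (φ x, t),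
    fun t x => φ.symm (ψ (φ x, t)), ?_, ?_, inter_subset_right, hrpos, hK0, ?_, ?_, ?_, ?_, ?_⟩
  · exact ((continuousOn_extChartAt x₀).isOpen_inter_preimage (isOpen_extChartAt_source x₀)
      Metric.isOpen_ball).inter hV
  · exact ⟨⟨mem_extChartAt_source x₀, Metric.mem_ball_self hrpos⟩, hx₀⟩
  · rintro t ht x ⟨⟨hxs, hxb⟩, -⟩
    have hxb₂ := Metric.ball_subset_ball hr₂ hxb
    have hxδ := Metric.ball_subset_ball hrδ hxb
    have ht₂ := ht.trans_le hr₂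
    obtain ⟨h1, h2, h3⟩ := hcurve x hxs hxb₂ t ht₂
    refine ⟨hflow x hxs hxb₂ t ht₂, h2 t right_mem_uIcc, _, h1, h2, h3, fun s => e (φ x, s),
      H.coeff_zero _ hxδ, rfl, fun s hs A B => ?_⟩
    exact (H.deriv_coeff _ hxδ s (((habs hs).trans_lt ht).trans_le hrδ) A B).hasDerivWithinAt
  · rintro t ht A B x ⟨⟨hxs, hxb⟩, -⟩
    have hxδ := Metric.ball_subset_ball hrδ hxb
    have h1 : ContDiffAt ℝ ω (fun y => e (y, t) A B) (φ x) := by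
      have h2 : ContDiffAt ℝ ω (fun y => e (y, t)) (φ x) :=
        ContDiffAt.comp (g := e) (φ x) (H.analytic_coeff _ hxδ t (ht.trans_le hrδ))
          (contDiffAt_id.prodMk contDiffAt_const)
      exact contDiffAt_pi.1 (contDiffAt_pi.1 h2 A) B
    have h3 : ContMDiffAt (𝓡 N) 𝓘(ℝ, EuclideanSpace ℝ (Fin N)) ω φ x :=
      contMDiffAt_extChartAt' (by rwa [hφ, extChartAt_source] at hxs)
    exact (ContMDiffAt.comp x h1.contMDiffAt h3).contMDiffWithinAt
  · rintro x ⟨⟨hxs, hxb⟩, -⟩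
    exact H.coeff_zero _ (Metric.ball_subset_ball hrδ hxb)
  · rintro t ht x ⟨⟨hxs, hxb⟩, -⟩ A B
    exact ⟨H.deriv_coeff _ (Metric.ball_subset_ball hrδ hxb) t (ht.trans_le hrδ) A B,
      (hΩ' _ (Metric.ball_subset_ball hr₂ hxb) t (ht.trans_le hr₂)).2 A B⟩
  · rintro t ht x ⟨⟨hxs, hxb⟩, -⟩ A
    have ht' : |-t| < r := by rwa [abs_neg]
    have hxb₂ := Metric.ball_subset_ball hr₂ hxb
    refine pushforward_eq_of_isLocalTransport hV hT H (min_le_left δ δ₁) hflow hxs hxb₂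
      (ht.trans_le hr₂) ?_ (hΩ' _ hxb₂ (-t) (ht'.trans_le hr₂)).1.1 A
    exact h₃ (hmem (lt_of_lt_of_le hxb hr₃) (ht'.trans_le hr₃))

end LocalTransport

/-! ### Generators under an invertible analytic change of frame -/

section Generators

/-- A dimension count: a basis extracted from `w` has at least as many elements as the independent
part of `v`. Only the cardinality is preserved, and the chosen indices may differ. -/
theorem exists_finset_linearIndependent {E : Type*} [AddCommGroup E] [Module ℝ E] {ι : Type*}
    [Finite ι] {v w : ι → E}
    (h : Submodule.span ℝ (range v) ≤ Submodule.span ℝ (range w)) {s : Finset ι}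
    (hs : LinearIndependent ℝ fun i : s => v i) :
    ∃ t : Finset ι, t.card = s.card ∧ LinearIndependent ℝ fun i : t => w i := by
  classical
  obtain ⟨κ, a, ha, hspan, hli⟩ := exists_linearIndependent' ℝ w
  have : Finite κ := Finite.of_injective a ha
  have := Fintype.ofFinite κ
  have hfin : FiniteDimensional ℝ (Submodule.span ℝ (range w)) :=
    FiniteDimensional.span_of_finite ℝ (finite_range w)
  have h1 : s.card ≤ Fintype.card κ := by
    rw [← Fintype.card_coe, ← finrank_span_eq_card hs, ← finrank_span_eq_card hli, hspan]
    exact Submodule.finrank_mono ((Submodule.span_mono (by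
      rintro _ ⟨i, rfl⟩; exact ⟨i, rfl⟩)).trans h)
  rw [← Finset.card_univ] at h1
  obtain ⟨t, -, ht⟩ := Finset.exists_subset_card_eq h1
  refine ⟨t.image a, by rw [Finset.card_image_of_injective _ ha, ht], ?_⟩
  have hmem : ∀ i : (t.image a : Finset ι), ∃ k, a k = i := fun i => by
    obtain ⟨k, -, hk⟩ := Finset.mem_image.1 i.2
    exact ⟨k, hk⟩
  choose b hb using hmem
  have hbinj : Function.Injective b := fun i i' h => Subtype.ext (by rw [← hb i, ← hb i', h])
  have h2 : (fun i : (t.image a : Finset ι) => w i) = (w ∘ a) ∘ b := by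
    funext i
    simp only [Function.comp_apply, hb]
  rw [h2]
  exact hli.comp b hbinj

variable {N : ℕ} {M : Type*} [TopologicalSpace M] [ChartedSpace (EuclideanSpace ℝ (Fin N)) M]

section AnalyticFun

variable {O : Set M} {κ : Type*} [Fintype κ]

theorem AnalyticFun.mul {f g : M → ℝ} (hf : AnalyticFun (N := N) O f)
    (hg : AnalyticFun (N := N) O g) : AnalyticFun (N := N) O (fun x => f x * g x) :=
  ContMDiffOn.mul hf hg

theorem AnalyticFun.sum {f : κ → M → ℝ} (hf : ∀ i, AnalyticFun (N := N) O (f i)) :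
    AnalyticFun (N := N) O (fun x => ∑ i, f i x) :=
  contMDiffOn_finsetSum fun i _ => hf i

theorem AnalyticFun.det [DecidableEq κ] {S : M → Matrix κ κ ℝ}
    (hS : ∀ A B, AnalyticFun (N := N) O (fun x => S x A B)) :
    AnalyticFun (N := N) O (fun x => (S x).det) := by
  simp only [Matrix.det_apply']
  refine AnalyticFun.sum fun σ => AnalyticFun.mul contMDiffOn_const ?_
  exact contMDiffOn_finsetProd fun i _ => hS _ _

/-- Cramer's rule: the entries are cofactors, polynomial in the entries of `S`, over a nonvanishing
determinant. -/
theorem AnalyticFun.matrix_inv [DecidableEq κ] {S : M → Matrix κ κ ℝ}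
    (hS : ∀ A B, AnalyticFun (N := N) O (fun x => S x A B)) (hdet : ∀ x ∈ O, (S x).det ≠ 0)
    (A B : κ) : AnalyticFun (N := N) O (fun x => (S x)⁻¹ A B) := by
  have h1 : AnalyticFun (N := N) O (fun x => (S x).adjugate A B) := by
    simp only [Matrix.adjugate_apply]
    refine AnalyticFun.det fun i j => ?_
    rcases eq_or_ne i B with rfl | h
    · simp only [Matrix.updateRow_self]
      exact contMDiffOn_const
    · simp only [Matrix.updateRow_ne h]
      exact hS i j
  have h2 : AnalyticFun (N := N) O (fun x => (S x).det⁻¹) := (AnalyticFun.det hS).inv₀ hdet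
  have h3 : ∀ x, (S x)⁻¹ A B = (S x).det⁻¹ * (S x).adjugate A B := fun x => by
    rw [Matrix.inv_def, Ring.inverse_eq_inv', Matrix.smul_apply, smul_eq_mul]
  simp only [h3]
  exact h2.mul h1

end AnalyticFun

variable [IsManifold (𝓡 N) ω M] {m : ℕ} {𝓓 : RiggedDistribution N M m}

/-- An invertible analytic matrix turns a set of generators into a set of generators on a smaller
connected open set. -/
theorem IsGenerators.of_matrix {ι : Type} [Fintype ι] [DecidableEq ι] {V U : Set M}
    {W W' : ι → VField N M} (hW : IsGenerators 𝓓 V W) (hU : IsOpen U) (hUc : IsConnected U)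
    (hUV : U ⊆ V) {S : M → Matrix ι ι ℝ}
    (hS : ∀ A B, AnalyticFun (N := N) U (fun x => S x A B)) (hdet : ∀ x ∈ U, (S x).det ≠ 0)
    (hW' : ∀ x ∈ U, ∀ A, W' A x = ∑ B, S x A B • W B x) : IsGenerators 𝓓 U W' := by
  obtain ⟨ha, hgen, s, hs, G, -, -, hVG, hli⟩ := hW
  have hinv : ∀ x ∈ U, ∀ B, W B x = ∑ A, (S x)⁻¹ B A • W' A x := by
    intro x hx B
    have h1 : (S x)⁻¹ * S x = 1 := Matrix.nonsing_inv_mul _ (hdet x hx).isUnit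
    have h2 : ∑ A, (S x)⁻¹ B A • W' A x = ∑ D, ((S x)⁻¹ * S x) B D • W D x := by
      simp only [hW' x hx, Finset.smul_sum, Matrix.mul_apply, Finset.sum_smul, smul_smul]
      exact Finset.sum_comm
    rw [h2, h1]
    simp [Matrix.one_apply]
  have ha' : ∀ A, AnalyticVF U (W' A) := fun A => by
    have h1 : AnalyticVF U (fun x => ∑ B, S x A B • W B x) :=
      AnalyticVF.sum fun B => AnalyticVF.smul (hS A B) ((ha B).mono hUV)
    exact ContMDiffOn.congr h1 fun x hx => by rw [hW' x hx]
  refine ⟨ha', fun O hO hOU Y => ?_, ?_⟩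
  · rw [hgen O hO (hOU.trans hUV)]
    constructor
    · rintro ⟨f, hf, hY⟩
      refine ⟨fun A x => ∑ B, f B x * (S x)⁻¹ B A, fun A => AnalyticFun.sum fun B => (hf B).mul
        ((AnalyticFun.matrix_inv hS hdet B A).mono hOU), fun x hx => ?_⟩
      rw [hY x hx]
      simp only [hinv x (hOU hx), Finset.smul_sum, Finset.sum_smul, smul_smul]
      exact Finset.sum_comm
    · rintro ⟨f, hf, hY⟩
      refine ⟨fun B x => ∑ A, f A x * S x A B, fun B => AnalyticFun.sum fun A => (hf A).mul
        ((hS A B).mono hOU), fun x hx => ?_⟩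
      rw [hY x hx]
      simp only [hW' x (hOU hx), Finset.smul_sum, Finset.sum_smul, smul_smul]
      exact Finset.sum_comm
  · obtain ⟨x₀, hx₀⟩ := hUc.nonempty
    -- At one point `x₁` of `U`, `p` of the `W` are independent and lie in the span of the `W'`, so
    -- some `p` of the `W'` are independent there; analyticity and connectedness spread this to an
    -- open dense set.
    obtain ⟨x₁, hx₁U, hx₁G⟩ := mem_closure_iff.1 (hVG (hUV hx₀)) U hU hx₀
    have hspan : Submodule.span ℝ (range fun A => W A x₁) ≤
        Submodule.span ℝ (range fun A => W' A x₁) := by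
      rw [Submodule.span_le]
      rintro _ ⟨B, rfl⟩
      simp only [SetLike.mem_coe]
      rw [hinv x₁ hx₁U B]
      exact Submodule.sum_mem _ fun A _ => Submodule.smul_mem _ _ (Submodule.subset_span ⟨A, rfl⟩)
    obtain ⟨t, ht, htl⟩ := exists_finset_linearIndependent hspan (hli x₁ hx₁G)
    obtain ⟨G', hG', hG'U, hUG', hl⟩ := linearIndependent_open_dense (κ := t) hU
      hUc.isPreconnected (fun i => ha' i) hx₁U htl
    exact ⟨t, ht.trans hs, G', hG', hG'U, hUG', hl⟩

end Generators

/-! ### The lexicographic order and decreasing times -/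

section Index

variable {ν : ℕ} {R : Fin (ν + 1) → ℕ}

theorem Index.LexLT.trans {A B D : Index ν R} (h₁ : A.LexLT B) (h₂ : B.LexLT D) : A.LexLT D := by
  simp only [Index.LexLT, Fin.lt_def, Fin.ext_iff] at *
  omega

theorem Index.LexLT.irrefl (A : Index ν R) : ¬ A.LexLT A := by
  simp [Index.LexLT]

theorem Index.lexLT_trichotomy {A B : Index ν R} (h : A ≠ B) : A.LexLT B ∨ B.LexLT A := by
  by_contra hcon
  refine h ?_
  obtain ⟨a, k, j⟩ := A
  obtain ⟨b, l, i⟩ := B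
  simp only [Index.LexLT, Index.ell, Index.a, Index.j, Fin.lt_def, Fin.ext_iff] at hcon
  have hab : a = b := Fin.ext (by omega)
  subst hab
  have hkl : k = l := Fin.ext (by omega)
  have hji : j = i := Fin.ext (by omega)
  rw [hkl, hji]

/-- There are numbers in `[ρ, 1]` which strictly decrease in the lexicographic order. -/
theorem Index.exists_strictAnti {ρ : ℝ} (hρ : ρ ∈ Ioo (0 : ℝ) 1) :
    ∃ s : Index ν R → ℝ, (∀ A, s A ∈ Icc ρ 1) ∧ ∀ A B, A.LexLT B → s B < s A := by
  classical
  -- `c A` collects the indices larger than `A`. It shrinks strictly along the order, so its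
  -- cardinality, scaled affinely into `[ρ, 1]`, gives the required numbers.
  let c : Index ν R → Finset (Index ν R) := fun A => Finset.univ.filter fun B => A.LexLT B
  have hρ' : 0 < 1 - ρ := sub_pos.2 hρ.2
  refine ⟨fun A => ρ + (1 - ρ) * ((c A).card / (Fintype.card (Index ν R) : ℝ)),
    fun A => ⟨?_, ?_⟩, fun A B hAB => ?_⟩
  · have : 0 ≤ (1 - ρ) * ((c A).card / (Fintype.card (Index ν R) : ℝ)) := by positivity
    linarith
  · have h1 : ((c A).card / (Fintype.card (Index ν R) : ℝ)) ≤ 1 :=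
      div_le_one_of_le₀ (by exact_mod_cast Finset.card_le_univ _) (by positivity)
    nlinarith
  · have h1 : c B ⊂ c A := by
      rw [Finset.ssubset_iff_of_subset]
      · exact ⟨B, by simpa [c] using hAB, by simpa [c] using Index.LexLT.irrefl B⟩
      · intro D hD
        simp only [c, Finset.mem_filter, Finset.mem_univ, true_and] at hD ⊢
        exact hAB.trans hD
    have h2 : ((c B).card : ℝ) < (c A).card := by exact_mod_cast Finset.card_lt_card h1
    have h3 : (0 : ℝ) < Fintype.card (Index ν R) := by
      exact_mod_cast Fintype.card_pos_iff.2 ⟨A⟩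
    have h4 := mul_lt_mul_of_pos_left (div_lt_div_of_pos_right h2 h3) hρ'
    linarith

end Index

/-! ### Surrogate fields of an adapted set of generators -/

section Surrogates

variable {N : ℕ} {M : Type*} [TopologicalSpace M] [ChartedSpace (EuclideanSpace ℝ (Fin N)) M]
  [IsManifold (𝓡 N) ω M] {m : ℕ} {𝓓 : RiggedDistribution N M m}
  {ν : ℕ} {R : Fin (ν + 1) → ℕ}

/-- The case of the defining brackets of `Vᴵᴵ` in which every `Yᵢ` is `T`. -/
theorem VII.adIter {V : Set M} (hV : IsOpen V) {T : VField N M} (hT : Represents 𝓓 V T)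
    {Z : VField N M} (hZ : AnalyticVF V Z) (hZI : ∀ x ∈ V, Z x ∈ 𝓓.DI x) (k : ℕ) :
    VII 𝓓 V (Rigged.adIter T k Z) := by
  have h1 := VII.bracket (𝓓 := 𝓓) V hV Z hZ hZI (List.replicate k T)
    (fun Y hY => by rw [List.eq_of_mem_replicate hY]; exact hT)
  have h2 : ∀ k : ℕ, (List.replicate k T).foldr
      (fun Y X => VectorField.mlieBracket (𝓡 N) Y X) Z = Rigged.adIter T k Z := by
    intro k
    induction k with
    | zero => rfl
    | succ k ih =>
      rw [List.replicate_succ, List.foldr_cons, ih]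
      simp only [Rigged.adIter, Function.iterate_succ_apply']
  exact h2 k ▸ h1

/-- The coefficients of the brackets of `T` with an adapted set of generators: a shift except in
the last row, where the coefficients are `f`. -/
def bracketCoeff (f : (a : Fin (ν + 1)) → Fin (R a) → Index ν R → M → ℝ) (A B : Index ν R)
    (x : M) : ℝ :=
  if h : (A.2.1 : ℕ) < A.1 then
    if (⟨A.1, ⟨A.2.1 + 1, Nat.succ_lt_succ h⟩, A.2.2⟩ : Index ν R) = B then 1 else 0
  else f A.1 A.2.2 B x

/-- At the end of a column, `ad^(a+1) W_{0(a)j}` belongs to `Vᴵᴵ`, so the generator property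
supplies analytic coefficients; elsewhere the bracket is the next entry of the column. -/
theorem exists_bracketCoeff {V : Set M} (hV : IsOpen V) {T : VField N M}
    (hT : Represents 𝓓 V T) {W₀ : (a : Fin (ν + 1)) → Fin (R a) → VField N M}
    (hW : IsAdapted 𝓓 V T W₀) :
    ∃ f : (a : Fin (ν + 1)) → Fin (R a) → Index ν R → M → ℝ,
      (∀ A B, AnalyticFun (N := N) V (bracketCoeff f A B)) ∧
      ∀ x ∈ V, ∀ A, VectorField.mlieBracket (𝓡 N) T (array T W₀ A) x =
        ∑ B, bracketCoeff f A B x • array T W₀ B x := by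
  have h1 : ∀ (a : Fin (ν + 1)) (j : Fin (R a)), VII 𝓓 V (adIter T ((a : ℕ) + 1) (W₀ a j)) := by
    intro a j
    refine VII.adIter hV hT (hW.generators.1 ⟨a, 0, j⟩) (fun x hx => ?_) _
    rw [hW.span_first_row x hx]
    exact Submodule.subset_span ⟨⟨a, j⟩, rfl⟩
  choose f hf hf' using fun a j => (hW.generators.2.1 V hV Subset.rfl _).1 (h1 a j)
  refine ⟨f, fun A B => ?_, fun x hx A => ?_⟩
  · unfold bracketCoeff
    split_ifs with h h'
    · exact contMDiffOn_const
    · exact contMDiffOn_const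
    · exact hf A.1 A.2.2 B
  · have h2 : VectorField.mlieBracket (𝓡 N) T (array T W₀ A) x =
        adIter T (A.ell + 1) (W₀ A.a A.j) x := by
      simp only [array, adIter, Function.iterate_succ_apply']
    rw [h2]
    obtain ⟨a, k, j⟩ := A
    by_cases h : (k : ℕ) < a
    · rw [Finset.sum_eq_single (⟨a, ⟨k + 1, Nat.succ_lt_succ h⟩, j⟩ : Index ν R)]
      · rw [bracketCoeff, dif_pos h, if_pos rfl, one_smul]
        rfl
      · intro B _ hB
        rw [bracketCoeff, dif_pos h, if_neg hB.symm, zero_smul]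
      · simp
    · have hk : (k : ℕ) = a := by omega
      have h3 : ∀ B x, bracketCoeff f ⟨a, k, j⟩ B x = f a j B x := fun B x => dif_neg h
      simp only [h3]
      rw [← hf' a j x hx]
      change adIter T ((k : ℕ) + 1) (W₀ a j) x = _
      rw [hk]

open scoped Classical in
/-- The value at time `t` of the fundamental solution of `e' = C e` along the integral curve of `T`
which starts from `x`. -/
def fundamentalSolution {ι : Type} [Fintype ι] [DecidableEq ι] (V : Set M) (T : VField N M) (C : ι → ι → M → ℝ)
    (t : ℝ) (x : M) : ι → ι → ℝ :=
  if h : ∃ e, Transports V T C t x e then h.choose else 0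

/-- The properties at the point `x` of the surrogate fields at the times `τ`. -/
def SurrogateAt (V : Set M) (T : VField N M) (W₀ : (a : Fin (ν + 1)) → Fin (R a) → VField N M)
    (C : Index ν R → Index ν R → M → ℝ) (τ : Index ν R → ℝ) (x : M) : Prop :=
  (∀ A, ∃ p, FlowsTo V T (-(τ A)) x p) ∧
  (∀ A B, ContMDiffAt (𝓡 N) 𝓘(ℝ, ℝ) ω
    (fun z => fundamentalSolution V T C (-(τ A)) z A.base B) x) ∧
  (Matrix.of fun A B => fundamentalSolution V T C (-(τ A)) x A.base B).det ≠ 0 ∧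
  ∀ A : Index ν R, pushforward V T (τ A) (W₀ A.a A.j) x =
    ∑ B, fundamentalSolution V T C (-(τ A)) x A.base B • array T W₀ B x

/-- The local transports come with one bound `K` for `e'` on all of `O`, and the determinant
threshold depends only on `s` and `K`; so a single `ε` serves every point of `O`. -/
theorem eventually_surrogateAt [T2Space M] {V : Set M} (hV : IsOpen V) {T : VField N M}
    (hT : AnalyticVF V T) {W₀ : (a : Fin (ν + 1)) → Fin (R a) → VField N M}
    (hW : ∀ A : Index ν R, AnalyticVF V (array T W₀ A))
    {f : (a : Fin (ν + 1)) → Fin (R a) → Index ν R → M → ℝ}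
    (hf : ∀ A B, AnalyticFun (N := N) V (bracketCoeff f A B))
    (hbr : ∀ x ∈ V, ∀ A, VectorField.mlieBracket (𝓡 N) T (array T W₀ A) x =
      ∑ B, bracketCoeff f A B x • array T W₀ B x)
    {s : Index ν R → ℝ} (hs : ∀ A, s A ∈ Icc (0 : ℝ) 1) (hinj : Function.Injective s)
    {x₀ : M} (hx₀ : x₀ ∈ V) :
    ∃ O ∈ 𝓝 x₀, ∃ ε > 0, ∀ w ∈ Ioo (0 : ℝ) ε, ∀ x ∈ O,
      SurrogateAt V T W₀ (bracketCoeff f) (fun A => w * s A) x := by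
  obtain ⟨O, r, K, e, z, hO, hxO, hOV, hr, hK, h1, h2, h3, h4, h5⟩ :=
    exists_local_transports hV hT hf hW hbr hx₀
  obtain ⟨w₀, hw₀, hdet⟩ := exists_det_ne_zero hs hinj hK
  have hfund : ∀ t, |t| < r → ∀ x ∈ O,
      fundamentalSolution V T (bracketCoeff f) t x = e t x := by
    intro t ht x hx
    have hex : ∃ e, Transports V T (bracketCoeff f) t x e := ⟨_, (h1 t ht x hx).2.2⟩
    rw [fundamentalSolution, dif_pos hex]
    exact Transports.unique hV hT (fun A B => (hf A B).continuousOn) hex.choose_spec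
      (h1 t ht x hx).2.2
  refine ⟨O, hO.mem_nhds hxO, min w₀ r, lt_min hw₀ hr, fun w hw x hx => ?_⟩
  have hww₀ : w < w₀ := hw.2.trans_le (min_le_left _ _)
  have hwr : w < r := hw.2.trans_le (min_le_right _ _)
  have habs : ∀ A, |w * s A| < r := fun A => by
    rw [abs_of_nonneg (mul_nonneg hw.1.le (hs A).1)]
    exact (mul_le_of_le_one_right hw.1.le (hs A).2).trans_lt hwr
  have habs' : ∀ A, |-(w * s A)| < r := fun A => by rw [abs_neg]; exact habs A
  refine ⟨fun A => ⟨_, (h1 _ (habs' A) x hx).1⟩, fun A B => ?_, ?_, fun A => ?_⟩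
  · refine ((h2 _ (habs' A) A.base B).contMDiffAt (hO.mem_nhds hx)).congr_of_eventuallyEq ?_
    filter_upwards [hO.mem_nhds hx] with z hz
    rw [hfund _ (habs' A) z hz]
  · have h6 := hdet w r hw.1 hww₀ hwr (fun t => e t x) (h3 x hx)
      -- Since `C` is a shift on these rows, `e' = C e` says that the derivative of row `k(a)j` is
      -- row `(k+1)(a)j`.
      (fun t ht a j k hk B => by
        have h7 := (h4 t ht x hx ⟨a, ⟨k, Nat.lt_of_succ_lt hk⟩, j⟩ B).1
        refine h7.congr_deriv ?_
        have h8 : k < (a : ℕ) := Nat.lt_of_succ_lt_succ hk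
        rw [Finset.sum_eq_single (⟨a, ⟨k + 1, hk⟩, j⟩ : Index ν R)]
        · rw [bracketCoeff, dif_pos h8, if_pos rfl, one_mul]
        · intro D _ hD
          rw [bracketCoeff, dif_pos h8, if_neg hD.symm, zero_mul]
        · simp)
      (fun t ht a j B => ⟨_, (h4 t ht x hx ⟨a, Fin.last a, j⟩ B).2,
        (h4 t ht x hx ⟨a, Fin.last a, j⟩ B).1⟩)
    have h9 : (fun A B : Index ν R =>
        fundamentalSolution V T (bracketCoeff f) (-(w * s A)) x A.base B) =
        fun A B => e (-(w * s A)) x A.base B := by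
      funext A B
      rw [hfund _ (habs' A) x hx]
    rw [h9]
    exact h6
  · rw [hfund _ (habs' A) x hx]
    exact h5 _ (habs A) x hx A.base

end Surrogates

end Rigged

end

/-! ### The theorem -/

theorem mainTheorem4 {N : ℕ} {M : Type*} [TopologicalSpace M] [T2Space M]
    [ChartedSpace (EuclideanSpace ℝ (Fin N)) M] [IsManifold (𝓡 N) ω M]
    {m : ℕ} (𝓓 : Rigged.RiggedDistribution N M m)
    {V : Set M} (hV : IsOpen V)
    {𝕋 : Rigged.VField N M} (h𝕋 : Rigged.Represents 𝓓 V 𝕋)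
    {ν : ℕ} {R : Fin (ν + 1) → ℕ} {W₀ : (a : Fin (ν + 1)) → Fin (R a) → Rigged.VField N M}
    (hW : Rigged.IsAdapted 𝓓 V 𝕋 W₀)
    {U : Set M} (hU : IsOpen U) (hUconn : IsConnected U)
    (hUcpt : IsCompact (closure U)) (hUV : closure U ⊆ V)
    {T : ℝ} (hT : 0 < T) {ρ : ℝ} (hρ : ρ ∈ Set.Ioo (0 : ℝ) 1) :
    ∃ ε₀ ∈ Set.Ioo (0 : ℝ) T, ∀ w ∈ Set.Ioo (0 : ℝ) ε₀,
      ∃ τ : Rigged.Index ν R → ℝ,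
        (∀ A, τ A ∈ Set.Icc (ρ * w) w) ∧
        (∀ A B : Rigged.Index ν R, A.LexLT B → τ B < τ A) ∧
        (∀ A, ∀ x ∈ U, ∃ p, Rigged.FlowsTo V 𝕋 (-(τ A)) x p) ∧
        Rigged.IsGenerators 𝓓 U
          (fun A : Rigged.Index ν R => Rigged.pushforward V 𝕋 (τ A) (W₀ A.a A.j)) := by
  obtain ⟨s, hsρ, hlex⟩ := Rigged.Index.exists_strictAnti (ν := ν) (R := R) hρ
  have hs : ∀ A, s A ∈ Set.Icc (0 : ℝ) 1 := fun A => ⟨hρ.1.le.trans (hsρ A).1, (hsρ A).2⟩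
  have hinj : Function.Injective s := by
    intro A B h
    by_contra hne
    rcases Rigged.Index.lexLT_trichotomy hne with h' | h'
    · exact (hlex _ _ h').ne h.symm
    · exact (hlex _ _ h').ne h
  obtain ⟨f, hf, hbr⟩ := Rigged.exists_bracketCoeff hV h𝕋 hW
  obtain ⟨ε, hε, hall⟩ : ∃ ε > 0, ∀ w ∈ Set.Ioo (0 : ℝ) ε, ∀ x ∈ closure U,
      Rigged.SurrogateAt V 𝕋 W₀ (Rigged.bracketCoeff f) (fun A => w * s A) x := by
    -- The property that one `ε` works at all points of a set passes to subsets and finite unions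
    -- and holds locally, hence on the compact closure.
    refine hUcpt.induction_on (p := fun O => ∃ ε > 0, ∀ w ∈ Set.Ioo (0 : ℝ) ε, ∀ x ∈ O,
      Rigged.SurrogateAt V 𝕋 W₀ (Rigged.bracketCoeff f) (fun A => w * s A) x)
      ⟨1, one_pos, by simp⟩ ?_ ?_ ?_
    · rintro O O' hOO' ⟨ε, hε, h⟩
      exact ⟨ε, hε, fun w hw x hx => h w hw x (hOO' hx)⟩
    · rintro O O' ⟨ε, hε, h⟩ ⟨ε', hε', h'⟩
      refine ⟨min ε ε', lt_min hε hε', fun w hw x hx => hx.elim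
        (h w ⟨hw.1, hw.2.trans_le (min_le_left _ _)⟩ x)
        (h' w ⟨hw.1, hw.2.trans_le (min_le_right _ _)⟩ x)⟩
    · intro x hx
      obtain ⟨O, hO, ε, hε, h⟩ := Rigged.eventually_surrogateAt hV h𝕋.1 hW.generators.1 hf hbr hs
        hinj (hUV hx)
      exact ⟨O, mem_nhdsWithin_of_mem_nhds hO, ε, hε, h⟩
  -- Halving `T` makes the threshold strictly smaller than `T`.
  refine ⟨min ε (T / 2), ⟨lt_min hε (by linarith), (min_le_right _ _).trans_lt (by linarith)⟩,
    fun w hw => ?_⟩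
  have hS : ∀ x ∈ U, _ := fun x hx =>
    hall w ⟨hw.1, hw.2.trans_le (min_le_left _ _)⟩ x (subset_closure hx)
  refine ⟨fun A => w * s A, fun A => ⟨?_, ?_⟩, fun A B hAB => ?_, fun A x hx => (hS x hx).1 A, ?_⟩
  · rw [mul_comm ρ]; exact mul_le_mul_of_nonneg_left (hsρ A).1 hw.1.le
  · exact mul_le_of_le_one_right hw.1.le (hsρ A).2
  · exact mul_lt_mul_of_pos_left (hlex A B hAB) hw.1
  · exact hW.generators.of_matrix hU hUconn (subset_closure.trans hUV)
      (fun A B x hx => ((hS x hx).2.1 A B).contMDiffWithinAt) (fun x hx => (hS x hx).2.2.1)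
      (fun x hx A => (hS x hx).2.2.2 A)
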